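/- **Conventions.** Let $\sigma$ be a finite relational signature. A $\sigma$-structure $A$ consists of a (possibly empty) set $\operatorname{dom}A$ and a relation $R^A\subseteq(\operatorname{dom}A)^{\operatorname{ar}(R)}$ for each $R\in\sigma$. A homomorphism preserves all relations; an embedding is an injective map that preserves and reflects all relations; substructures are induced; the $\sigma$-reduct of a structure over a larger signature forgets the relations outside $\sigma$. The incidence multigraph of $A$ has as vertices the elements of $A$ and the pairs $(\bar x,R)$ with $\bar x\in R^A$, with one edge between $(\bar x,R)$ and $x_i$ for every index $i$; $A$ is a $\sigma$-tree if this multigraph is a tree. The Gaifman graph of $A$ has vertex set $\operatorname{dom}A$, two distinct elements being adjacent if they occur in a common tuple of a relation of $A$. Let $\mathcal F$ be a (possibly infinite) set of finite $\sigma$-trees, and let $\mathrm{Forb}_h(\mathcal F)$ be the class of all finite $\sigma$-structures $A$ such that no $F\in\mathcal F$ admits a homomorphism to $A$. **Pieces.** Let $F\in\mathcal F$ and let $m$ be a vertex whose deletion disconnects the Gaifman graph of $F$ (a *cut*). For each connected component $D$ of the Gaifman graph with $m$ deleted, the rooted structure $(M,m)$, where $M$ is the substructure of $F$ induced by $D\cup\{m\}$,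 is a *piece* of $F$. The join $(A,a)\oplus(B,b)$ of rooted structures is the disjoint union of $A$ and $B$ with $a$ and $b$ identified. Put $$\mathfrak I(A,a)=\{(B,b):\ (A,a)\oplus(B,b)\cong F\text{ for some }F\in\mathcal F\}.$$ Two pieces $(M,m)$ and $(M',m')$ of members of $\mathcal F$ are equivalent, $(M,m)\equiv(M',m')$, if $\mathfrak I(M,m)=\mathfrak I(M',m')$. Let $\mathcal P(\mathcal F)$ be the set of $\equiv$-classes of all pieces of members of $\mathcal F$. **Expanded class.** Let $\tau$ consist of one unary symbol $S_{\mathfrak M}$ for each $\mathfrak M\in\mathcal P(\mathcal F)$. A finite $(\sigma\cup\tau)$-structure $A$ with $\sigma$-reduct $A^*$ is *canonical* if $A^*\in\mathrm{Forb}_h(\mathcal F)$ and, for all $\mathfrak M\in\mathcal P(\mathcal F)$ and $x\in\operatorname{dom}A$, $$x\in S_{\mathfrak M}^A\iff\text{there are }(M,m)\in\mathfrak M\text{ and a homomorphism }f:M\to A^*\text{ with }f(m)=x.$$ The expanded class $\mathcal C$ consists of all substructures of canonical structures (up to isomorphism). The *ordered expanded class* $\vec{\mathcal C}$ for $\mathrm{Forb}_h(\mathcal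 F)$ consists of all $(\sigma\cup\tau\cup\{\preceq\})$-structures $A$ such that $\preceq^A$ is a linear ordering of $\operatorname{dom}A$ and the $(\sigma\cup\tau)$-reduct of $A$ is in $\mathcal C$. **Theorem.** Let $\sigma$ be a finite relational signature and let $\mathcal F$ be a set of finite $\sigma$-trees. Then the ordered expanded class $\vec{\mathcal C}$ for $\mathrm{Forb}_h(\mathcal F)$ is a Ramsey class: for all $A,B\in\vec{\mathcal C}$ and every natural number $r$ there is $C\in\vec{\mathcal C}$ with $C\to(B)^A_r$, that is, for every colouring of the embeddings of $A$ into $C$ with $r$ colours there are an embedding $g:B\to C$ and a colour $j$ such that $g\circ f$ has colour $j$ for every embedding $f:A\to B$. -/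

import Mathlib

open CategoryTheory FirstOrder.Language
open scoped FirstOrder

/-!
Structures over a relational signature are structures, in the sense of Mathlib's model theory,
over a language without function symbols; homomorphisms `A →[L] B`, embeddings `A ↪[L] B`
(injective and preserving relations in both directions) and isomorphisms `A ≃[L] B` are Mathlib's.
Classes of structures are sets of bundled structures.
-/

universe w v w' v' u

namespace RamseyTrees

/-! ### Reducts, the partition arrow, Ramsey classes -/

/-- The reduct of a structure along a map of languages. -/
def reduct {L : FirstOrder.Language.{w, v}} {L' : FirstOrder.Language.{w', v'}} (φ : L →ᴸ L')
    (A : Bundled.{u} L'.Structure) : Bundled.{u} L.Structure :=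
  ⟨A, φ.reduct A⟩

/-- The partition arrow `C ⟶ (B)^A_r`: for every colouring of the embeddings of `A` into `C` by `r`
colours there is an embedding `g` of `B` into `C` such that all embeddings of `A` into the copy
`g[B]`, that is, all `g ∘ f` with `f` an embedding of `A` into `B`, have the same colour. -/
def Arrow {L : FirstOrder.Language.{w, v}} (C B A : Bundled.{u} L.Structure) (r : ℕ) : Prop :=
  ∀ χ : (A ↪[L] C) → Fin r, ∃ (g : B ↪[L] C) (j : Fin r), ∀ f : A ↪[L] B, χ (g.comp f) = j

/-- A class of structures is a Ramsey class if it has the `A`-Ramsey property for each of its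
members `A`. -/
def IsRamseyClass {L : FirstOrder.Language.{w, v}} (K : Set (Bundled.{u} L.Structure)) : Prop :=
  ∀ A ∈ K, ∀ B ∈ K, ∀ r : ℕ, ∃ C ∈ K, Arrow C B A r

/-! ### Incidence graph, Gaifman graph, trees -/

section Trees

variable {σ : FirstOrder.Language.{w, v}}

/-- The tuples of the relations of `A`, each labelled by its relation symbol. -/
structure RelTuple (A : Bundled.{u} σ.Structure) where
  arity : ℕ
  rel : σ.Relations arity
  val : Fin arity → A
  holds : Structure.RelMap rel val

/-- The simple graph underlying the incidence multigraph: an element is joined to every tuple in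
which it occurs. In the multigraph the number of parallel edges between an element and a tuple is
the number of occurrences. -/
def incGraph (A : Bundled.{u} σ.Structure) : SimpleGraph (A ⊕ RelTuple A) :=
  SimpleGraph.fromRel fun p q =>
    match p, q with
    | Sum.inl a, Sum.inr t => a ∈ Set.range t.val
    | _, _ => False

/-- `A` is a `σ`-tree: its incidence multigraph is a tree, that is, it has no parallel edges (no
element occurs twice in a tuple) and the underlying simple graph is a tree. -/
def IsSigmaTree (A : Bundled.{u} σ.Structure) : Prop :=
  (∀ t : RelTuple A, Function.Injective t.val) ∧ (incGraph A).IsTree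

/-- The Gaifman graph: two distinct elements are adjacent if they occur in a common tuple. -/
def gaifman (A : Bundled.{u} σ.Structure) : SimpleGraph A where
  Adj x y := x ≠ y ∧ ∃ t : RelTuple A, x ∈ Set.range t.val ∧ y ∈ Set.range t.val
  symm := ⟨fun _ _ ⟨h, t, hx, hy⟩ => ⟨h.symm, t, hy, hx⟩⟩
  loopless := ⟨fun _ h => h.1 rfl⟩

/-- The Gaifman graph of `A` with the vertex `m` deleted. -/
abbrev gaifmanDelete (A : Bundled.{u} σ.Structure) (m : A) : SimpleGraph ({m}ᶜ : Set A) :=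
  (gaifman A).induce {m}ᶜ

/-- `m` is a cut of (the tree) `A`: deleting `m` disconnects the Gaifman graph. -/
def IsCut (A : Bundled.{u} σ.Structure) (m : A) : Prop :=
  ¬ (gaifmanDelete A m).Preconnected

end Trees

/-! ### Sums, factor structures and joins -/

section Join

variable {σ : FirstOrder.Language.{w, v}} [σ.IsRelational]

/-- The sum (disjoint union) of two structures. -/
def sumStr (A B : Bundled.{u} σ.Structure) : Bundled.{u} σ.Structure where
  α := A ⊕ B
  str :=
    { RelMap := fun R z =>
        (∃ x : Fin _ → A, Structure.RelMap R x ∧ z = Sum.inl ∘ x) ∨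
        (∃ y : Fin _ → B, Structure.RelMap R y ∧ z = Sum.inr ∘ y) }

/-- The factor structure of `A` by an equivalence relation. -/
def factorStr (A : Bundled.{u} σ.Structure) (s : Setoid A) : Bundled.{u} σ.Structure where
  α := Quotient s
  str :=
    { RelMap := fun R z => ∃ x : Fin _ → A, Structure.RelMap R x ∧ z = Quotient.mk s ∘ x }

/-- The equivalence relation on `A ⊕ B` whose only nontrivial identification is that of `a`
with `b`. -/
def joinSetoid {A B : Type u} (a : A) (b : B) : Setoid (A ⊕ B) where
  r p q := p = q ∨ (p = Sum.inl a ∧ q = Sum.inr b) ∨ (p = Sum.inr b ∧ q = Sum.inl a)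
  iseqv :=
    { refl := fun _ => Or.inl rfl
      symm := by
        rintro p q (h | ⟨h, h'⟩ | ⟨h, h'⟩)
        · exact Or.inl h.symm
        · exact Or.inr (Or.inr ⟨h', h⟩)
        · exact Or.inr (Or.inl ⟨h', h⟩)
      trans := by
        rintro p q s (rfl | ⟨rfl, rfl⟩ | ⟨rfl, rfl⟩) (rfl | ⟨h, rfl⟩ | ⟨h, rfl⟩) <;> simp_all }

/-- Rooted `σ`-structures. -/
structure Rooted (σ : FirstOrder.Language.{w, v}) where
  str : Bundled.{u} σ.Structure
  root : str

/-- The join `(A, a) ⊕ (B, b)`: the sum of `A` and `B` with `a` and `b` identified. -/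
def join (X Y : Rooted.{w, v, u} σ) : Bundled.{u} σ.Structure :=
  factorStr (sumStr X.str Y.str) (joinSetoid X.root Y.root)

/-- The set of all rooted structures that are incompatible with `X`: those whose join with `X`
is isomorphic to a member of `𝓕`. -/
def incompatible (𝓕 : Set (Bundled.{u} σ.Structure)) (X : Rooted.{w, v, u} σ) :
    Set (Rooted.{w, v, u} σ) :=
  {Y | ∃ F ∈ 𝓕, Nonempty (join X Y ≃[σ] F)}

end Join

/-! ### Pieces and their equivalence classes -/

section Pieces

variable {σ : FirstOrder.Language.{w, v}} [σ.IsRelational]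

/-- The substructure induced by a set of elements. -/
def induced (A : Bundled.{u} σ.Structure) (S : Set A) : Bundled.{u} σ.Structure :=
  ⟨(⟨S, fun f => isEmptyElim f⟩ : σ.Substructure A), inferInstance⟩

/-- The data determining a piece of a member of `𝓕`: a member `F` of `𝓕`, a cut `m` of `F` and a
connected component of the Gaifman graph of `F` with `m` deleted. -/
structure Piece (𝓕 : Set (Bundled.{u} σ.Structure)) where
  tree : Bundled.{u} σ.Structure
  mem : tree ∈ 𝓕
  cut : tree
  isCut : IsCut tree cut
  component : (gaifmanDelete tree cut).ConnectedComponent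

variable {𝓕 : Set (Bundled.{u} σ.Structure)}

/-- The domain of a piece: the component together with the cut. -/
def Piece.domain (p : Piece 𝓕) : Set p.tree :=
  insert p.cut (Subtype.val '' p.component.supp)

/-- The piece as a rooted structure `(M, m)`. -/
def Piece.rooted (p : Piece 𝓕) : Rooted.{w, v, u} σ where
  str := induced p.tree p.domain
  root := ⟨p.cut, Set.mem_insert _ _⟩

/-- Two pieces are equivalent if they have the same incompatible rooted structures. -/
def pieceSetoid (𝓕 : Set (Bundled.{u} σ.Structure)) : Setoid (Piece 𝓕) where
  r p q := incompatible 𝓕 p.rooted = incompatible 𝓕 q.rooted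
  iseqv := ⟨fun _ => rfl, fun h => h.symm, fun h h' => h.trans h'⟩

/-- The equivalence classes of pieces of members of `𝓕`. -/
def PieceClass (𝓕 : Set (Bundled.{u} σ.Structure)) := Quotient (pieceSetoid 𝓕)

/-- The relation symbols of `τ`: one unary symbol for each equivalence class of pieces. -/
inductive PieceRel (𝓕 : Set (Bundled.{u} σ.Structure)) : ℕ → Type (max w v (u + 1))
  | S : PieceClass 𝓕 → PieceRel 𝓕 1

/-- The signature `τ`. -/
def pieceLang (𝓕 : Set (Bundled.{u} σ.Structure)) : FirstOrder.Language.{0, max w v (u + 1)} :=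
  ⟨fun _ => Empty, PieceRel 𝓕⟩

end Pieces

/-! ### The expanded class and the ordered expanded class -/

section Classes

variable {σ : FirstOrder.Language.{w, v}} [σ.IsRelational]

/-- The class of all finite structures that admit no homomorphism from any member of `𝓕`. -/
def Forbh (𝓕 : Set (Bundled.{u} σ.Structure)) : Set (Bundled.{u} σ.Structure) :=
  {A | Finite A ∧ ∀ F ∈ 𝓕, IsEmpty (F →[σ] A)}

/-- The expanded signature `σ ∪ τ`. -/
abbrev expLang (𝓕 : Set (Bundled.{u} σ.Structure)) : FirstOrder.Language :=
  σ.sum (pieceLang 𝓕)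

/-- The unary symbol of the expanded signature that belongs to a class of pieces. -/
def pieceSymb {𝓕 : Set (Bundled.{u} σ.Structure)} (𝔐 : PieceClass 𝓕) :
    (expLang 𝓕).Relations 1 :=
  Sum.inr (PieceRel.S 𝔐)

/-- The canonical structures: the `σ`-reduct is in `Forbh 𝓕`, and `x` belongs to the relation of
the class `𝔐` if and only if some piece `(M, m)` in `𝔐` has a homomorphism to the `σ`-reduct that
takes `m` to `x`. -/
def canonicalClass (𝓕 : Set (Bundled.{u} σ.Structure)) :
    Set (Bundled.{u} (expLang 𝓕).Structure) :=
  {A | reduct LHom.sumInl A ∈ Forbh 𝓕 ∧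
    ∀ (𝔐 : PieceClass 𝓕) (x : A), Structure.RelMap (pieceSymb 𝔐) ![x] ↔
      ∃ p : Piece 𝓕, Quotient.mk (pieceSetoid 𝓕) p = 𝔐 ∧
        ∃ f : p.rooted.str →[σ] reduct LHom.sumInl A, f p.rooted.root = x}

/-- The expanded class: all substructures of canonical structures (up to isomorphism, that is, all
structures that embed in a canonical structure). -/
def expandedClass (𝓕 : Set (Bundled.{u} σ.Structure)) :
    Set (Bundled.{u} (expLang 𝓕).Structure) :=
  {A | ∃ A' ∈ canonicalClass 𝓕, Nonempty (A ↪[expLang 𝓕] A')}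

/-- The signature of ordered `σ ∪ τ`-structures. -/
abbrev ordLang (𝓕 : Set (Bundled.{u} σ.Structure)) : FirstOrder.Language :=
  (expLang 𝓕).sum FirstOrder.Language.order

/-- The ordered expanded class: the interpretation of the order symbol is a linear ordering, and
the reduct to `σ ∪ τ` is in the expanded class. -/
def orderedExpandedClass (𝓕 : Set (Bundled.{u} σ.Structure)) :
    Set (Bundled.{u} (ordLang 𝓕).Structure) :=
  {A | (∃ _ : LinearOrder A, (ordLang 𝓕).OrderedStructure A) ∧
    reduct LHom.sumInl A ∈ expandedClass 𝓕}

end Classes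

end RamseyTrees

/-!
The class of canonical structures is closed under covers: a finite structure `Z` that is the union
of embedded copies of a canonical structure `P` is again canonical
(`closedUnderCovers_canonicalClass`). Granting this, the theorem follows from the partite
construction of Nešetřil and Rödl. If `B` embeds in the canonical structure `P`, start with disjoint
copies of `P`, one for each increasing map of `B` into a long finite chain, and let `π` map each copy
of `B` to the chain accordingly. For every increasing map `ι` of `A` into the chain, the Hales–Jewett
theorem yields a structure in which the copies of `A` that lie over `ι` are monochromatic in some
copy of the preceding structure (`exists_partite_step`). This structure is a union of copies of the
preceding one, so everything stays canonical. At the end, the colour of a copy of `A` depends only on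
the map `ι` that it lies over (`exists_partite`), and Ramsey's theorem for the chain provides a
monochromatic copy of `B` (`exists_ramsey_of_closedUnderCovers`). The final structure is ordered
compatibly with `π`.

For the closure under covers, let a piece `(M, m)` be mapped to `Z`, with `m` going to an element
`x` of some copy of `P`; one has to find an equivalent piece that maps to `P` with its root going to
`x` (`realizes_of_hom`). Since the unary relations of `Z` restrict to those of each copy of `P`, and
`P` is canonical, it does not matter which copy is meant. Choose the tuple `t` of `M` that contains
`m`; its image lies in one of the copies. As `M` comes from a tree, it is a gluing of branches to `t`
(`branch_isGlue`), and these are smaller pieces. By induction each of them has an equivalent piece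
that maps to the copy containing `t`. Replacing the branches by these pieces yields a structure that
maps to this copy. Replacing a part of a gluing by an equivalent one changes neither membership in
`𝓕` nor incompatibility (`incompatible_glueStr_congr`), so the result is equivalent to `(M, m)`, and
it is again a piece (`exists_piece_of_isJoin`). Likewise a homomorphism from a member of `𝓕` to `Z`
would give one from a member of `𝓕` to `P` (`isEmpty_hom_of_isCover`).
-/

namespace RamseyTrees

/-! ### Ramsey's theorem for finite sets of natural numbers -/

theorem exists_eventually_eq_of_ultrafilter (U : Ultrafilter ℕ) {r : ℕ} (f : ℕ → Fin r) :
    ∃ j, ∀ᶠ n in (U : Filter ℕ), f n = j := by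
  obtain ⟨j, hj⟩ := (U.map f).eq_pure_of_finite
  refine ⟨j, ?_⟩
  have h : ({j} : Set (Fin r)) ∈ U.map f := by rw [hj]; exact Ultrafilter.mem_pure.2 rfl
  exact h

/-- The colour of `insert n s` for almost all `n` with respect to a nonprincipal ultrafilter. -/
noncomputable def limitColour {r : ℕ} (c : Finset ℕ → Fin r) (s : Finset ℕ) : Fin r :=
  (exists_eventually_eq_of_ultrafilter (Filter.hyperfilter ℕ) fun n => c (insert n s)).choose

theorem eventually_eq_limitColour {r : ℕ} (c : Finset ℕ → Fin r) (s : Finset ℕ) :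
    ∀ᶠ n in (Filter.hyperfilter ℕ : Filter ℕ), c (insert n s) = limitColour c s :=
  (exists_eventually_eq_of_ultrafilter (Filter.hyperfilter ℕ) fun n => c (insert n s)).choose_spec

/-- A homogeneous set for a colouring of the `a`-subsets of `ℕ` is built element by element: each
subset `s` with `k ≤ a` elements must have the constant colour in the `(a - k)`-th limit of the
colouring, which almost every new element respects. -/
theorem exists_homogeneous_of_nat (a b : ℕ) {r : ℕ} (c : Finset ℕ → Fin r) :
    ∃ (H : Finset ℕ) (j : Fin r), H.card = b ∧ ∀ s ⊆ H, s.card = a → c s = j := by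
  suffices h : ∃ H : Finset ℕ, H.card = b ∧
      ∀ s ⊆ H, s.card ≤ a → limitColour^[a - s.card] c s = limitColour^[a] c ∅ by
    obtain ⟨H, hb, hH⟩ := h
    refine ⟨H, limitColour^[a] c ∅, hb, fun s hs ha => ?_⟩
    simpa [ha] using hH s hs ha.le
  induction b with
  | zero => exact ⟨∅, rfl, fun s hs _ => by simp [Finset.subset_empty.1 hs]⟩
  | succ b ih =>
    obtain ⟨H, hb, hH⟩ := ih
    have h₁ : ∀ᶠ n in (Filter.hyperfilter ℕ : Filter ℕ), ∀ s ∈ H.powerset, ∀ i ∈ Finset.range a,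
        limitColour^[i] c (insert n s) = limitColour^[i + 1] c s := by
      rw [Filter.eventually_all_finset]
      intro s _
      rw [Filter.eventually_all_finset]
      intro i _
      rw [Function.iterate_succ_apply']
      exact eventually_eq_limitColour _ s
    have h₂ : ∀ᶠ n in (Filter.hyperfilter ℕ : Filter ℕ), n ∉ H :=
      Filter.notMem_hyperfilter_of_finite (s := (H : Set ℕ)) H.finite_toSet |>
        Ultrafilter.compl_mem_iff_notMem.2
    obtain ⟨n, hn, hnH⟩ := (h₁.and h₂).exists
    refine ⟨insert n H, by rw [Finset.card_insert_of_notMem hnH, hb], fun s hs ha => ?_⟩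
    by_cases hns : n ∈ s
    · have hsub : s.erase n ⊆ H := by
        intro x hx
        exact (Finset.mem_insert.1 (hs (Finset.mem_of_mem_erase hx))).resolve_left
          (Finset.ne_of_mem_erase hx)
      have hcard : (s.erase n).card + 1 = s.card := Finset.card_erase_add_one hns
      have := hn _ (Finset.mem_powerset.2 hsub) (a - s.card) (Finset.mem_range.2 (by omega))
      rw [Finset.insert_erase hns] at this
      rw [this, ← hH _ hsub (by omega)]
      rw [show a - (s.erase n).card = a - s.card + 1 by omega]
    · exact hH s ((Finset.subset_insert_iff_of_notMem hns).1 hs) ha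

/-- Finite Ramsey theorem. If it failed, the ultrafilter limit of counterexamples on `{0, …, N - 1}`
would be a colouring of the subsets of `ℕ` without homogeneous sets. -/
theorem exists_homogeneous (a b r : ℕ) :
    ∃ N : ℕ, ∀ c : Finset ℕ → Fin r, ∃ (H : Finset ℕ) (j : Fin r),
      H ⊆ Finset.range N ∧ H.card = b ∧ ∀ s ⊆ H, s.card = a → c s = j := by
  by_contra! hcon
  choose c hc using hcon
  choose d hd using fun s =>
    exists_eventually_eq_of_ultrafilter (Filter.hyperfilter ℕ) fun N => c N s
  obtain ⟨H, j, hb, hH⟩ := exists_homogeneous_of_nat a b d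
  have h₁ : ∀ᶠ N in (Filter.hyperfilter ℕ : Filter ℕ), ∀ s ∈ H.powerset, c N s = d s := by
    rw [Filter.eventually_all_finset]
    exact fun s _ => hd s
  have h₂ : ∀ᶠ N in (Filter.hyperfilter ℕ : Filter ℕ), H ⊆ Finset.range N := by
    have h : ∀ᶠ N in Filter.atTop, H ⊆ Finset.range N :=
      Filter.tendsto_finset_range.eventually (Filter.eventually_ge_atTop H)
    rw [← Nat.cofinite_eq_atTop] at h
    exact Filter.hyperfilter_le_cofinite h
  obtain ⟨N, hN, hHN⟩ := (h₁.and h₂).exists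
  obtain ⟨s, hs, hsa, hne⟩ := hc N H j hHN hb
  exact hne ((hN s (Finset.mem_powerset.2 hs)).trans (hH s hs hsa))

/-- Ramsey's theorem for strictly monotone maps between finite linear orders. -/
theorem exists_homogeneous_strictMono (A B : Type u) [LinearOrder A] [Finite A] [LinearOrder B]
    [Finite B] {r : ℕ} (hr : 0 < r) :
    ∃ N : ℕ, ∀ c : (A → Fin N) → Fin r, ∃ (κ : B → Fin N) (j : Fin r), StrictMono κ ∧
      ∀ f : A → B, StrictMono f → c (κ ∘ f) = j := by
  classical
  have := Fintype.ofFinite A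
  have := Fintype.ofFinite B
  obtain ⟨N, hN⟩ := exists_homogeneous (Fintype.card A) (Fintype.card B) r
  refine ⟨N, fun c => ?_⟩
  let im (g : A → Fin N) : Finset ℕ := Finset.univ.image fun a => (g a : ℕ)
  have im_inj : ∀ g g' : A → Fin N, StrictMono g → StrictMono g' → im g = im g' → g = g' := by
    intro g g' hg hg' h
    have hv : (fun a => (g a : ℕ)) = fun a => (g' a : ℕ) := by
      refine (StrictMono.range_inj (Fin.val_strictMono.comp hg) (Fin.val_strictMono.comp hg')).1 ?_
      have := congrArg (fun s : Finset ℕ => (s : Set ℕ)) h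
      simpa [im, Function.comp_def] using this
    exact funext fun a => Fin.ext (congrFun hv a)
  let c' (s : Finset ℕ) : Fin r :=
    if h : ∃ g : A → Fin N, StrictMono g ∧ im g = s then c h.choose else ⟨0, hr⟩
  have hc' : ∀ g : A → Fin N, StrictMono g → c' (im g) = c g := by
    intro g hg
    have h : ∃ g' : A → Fin N, StrictMono g' ∧ im g' = im g := ⟨g, hg, rfl⟩
    simp only [c', dif_pos h]
    rw [im_inj _ _ h.choose_spec.1 hg h.choose_spec.2]
  obtain ⟨H, j, hHN, hHb, hH⟩ := hN c'
  let e : B ↪o ℕ := (Fintype.orderIsoFinOfCardEq B rfl).symm.toOrderEmbedding.trans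
    (H.orderEmbOfFin hHb)
  have he : ∀ b, e b ∈ H := fun b => H.orderEmbOfFin_mem hHb _
  refine ⟨fun b => ⟨e b, Finset.mem_range.1 (hHN (he b))⟩, j, fun _ _ h => e.strictMono h,
    fun f hf => ?_⟩
  rw [← hc' _ fun _ _ h => e.strictMono (hf h)]
  refine hH _ (fun n hn => ?_) ?_
  · obtain ⟨a, -, rfl⟩ := Finset.mem_image.1 hn
    exact he _
  · exact (Finset.card_image_of_injective _ (e.injective.comp hf.injective)).trans
      Finset.card_univ

/-! ### Covers of structures by copies of a structure -/

section Covers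

variable {L : FirstOrder.Language.{w, v}}

/-- The embeddings `G l` of `P` into `Z` cover all elements and all tuples of `Z`. -/
structure IsCover (P Z : Bundled.{u} L.Structure) {Λ : Type u} (G : Λ → (P ↪[L] Z)) : Prop where
  exists_eq : ∀ z, ∃ l x, G l x = z
  exists_comp_eq : ∀ {n} (R : L.Relations n) (z : Fin n → Z), Structure.RelMap R z →
    ∃ l x, G l ∘ x = z

/-- A class of structures is closed under covers if it contains every finite structure covered by
embedded copies of one of its members. -/
def ClosedUnderCovers (K : Set (Bundled.{u} L.Structure)) : Prop :=
  ∀ P ∈ K, ∀ (Z : Bundled.{u} L.Structure) (Λ : Type u) (G : Λ → (P ↪[L] Z)),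
    Finite Z → Nonempty Λ → IsCover P Z G → Z ∈ K

variable [L.IsRelational]

/-- The union of the images of `P` under a family of maps into a type. -/
def unionStr (P : Bundled.{u} L.Structure) {Λ V : Type u} (G : Λ → P → V) :
    Bundled.{u} L.Structure where
  α := {z : V // ∃ l x, G l x = z}
  str :=
    { RelMap := fun R z => ∃ l x, Structure.RelMap R x ∧ ∀ i, G l (x i) = (z i).1 }

/-- The element of the ambient type. -/
def unionVal {P : Bundled.{u} L.Structure} {Λ V : Type u} {G : Λ → P → V} (z : unionStr P G) : V :=
  Subtype.val z

theorem exists_unionVal_eq {P : Bundled.{u} L.Structure} {Λ V : Type u} {G : Λ → P → V}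
    (z : unionStr P G) : ∃ x l, unionVal z = G l x := by
  obtain ⟨z, l, x, rfl⟩ := z
  exact ⟨x, l, rfl⟩

theorem unionVal_injective {P : Bundled.{u} L.Structure} {Λ V : Type u} {G : Λ → P → V} :
    Function.Injective (unionVal (P := P) (G := G)) :=
  Subtype.val_injective

theorem finite_unionStr (P : Bundled.{u} L.Structure) [Finite P] {Λ V : Type u} [Finite Λ]
    (G : Λ → P → V) : Finite (unionStr P G) := by
  have h : Function.Surjective
      fun q : Λ × P => (⟨G q.1 q.2, q.1, q.2, rfl⟩ : {z : V // ∃ l x, G l x = z}) := by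
    rintro ⟨z, l, x, rfl⟩
    exact ⟨(l, x), rfl⟩
  exact Finite.of_surjective _ h

theorem exists_isCover_unionStr (P : Bundled.{u} L.Structure) {Λ V : Type u} (G : Λ → P → V)
    (hinj : ∀ l, Function.Injective (G l))
    (hcompat : ∀ l l' n (R : L.Relations n) (x y : Fin n → P), Structure.RelMap R y →
      (∀ i, G l (x i) = G l' (y i)) → Structure.RelMap R x) :
    ∃ g : Λ → (P ↪[L] unionStr P G), (∀ l x, unionVal (g l x) = G l x) ∧ IsCover P (unionStr P G) g := by
  refine ⟨fun l => ⟨⟨fun x => ⟨G l x, l, x, rfl⟩, fun x y h => hinj l (congrArg Subtype.val h)⟩,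
    fun f => isEmptyElim f, fun R x => ⟨?_, fun h => ⟨l, x, h, fun _ => rfl⟩⟩⟩,
    fun _ _ => rfl, ?_, ?_⟩
  · rintro ⟨l', y, hy, h⟩
    exact hcompat l l' _ R x y hy fun i => (h i).symm
  · rintro ⟨z, l, x, rfl⟩
    exact ⟨l, x, rfl⟩
  · rintro n R z ⟨l, x, -, h⟩
    exact ⟨l, x, funext fun i => Subtype.ext (h i)⟩

end Covers

/-! ### The partite construction -/

section Partite

open Combinatorics

variable {L : FirstOrder.Language.{w, v}}

/-- For a line `l` in a power of the set of embeddings of `A` into `P` that lie over `ι`, the map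
that sends an element `x` of the part `ι a` to the vector with coordinates `x` (at the active
coordinates of `l`) and `f a` (at the coordinates where `l` is constantly `f`). Elements in the
other parts get a separate copy for each line. -/
noncomputable def lineMap {A P : Bundled.{u} L.Structure} {T : Type*} (π : P → T) (ι : A → T)
    {d : Type} (l : Line {f : A ↪[L] P // ∀ a, π (f a) = ι a} d) (x : P) :
    (d → P) ⊕ (Line {f : A ↪[L] P // ∀ a, π (f a) = ι a} d × P) :=
  open Classical in
  if h : ∃ a, π x = ι a then Sum.inl fun i => (l.idxFun i).elim x fun f => f.1 h.choose
  else Sum.inr (l, x)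

variable {A P : Bundled.{u} L.Structure} {T : Type*} {π : P → T} {ι : A → T} {d : Type}

theorem lineMap_of_eq (hι : Function.Injective ι)
    (l : Line {f : A ↪[L] P // ∀ a, π (f a) = ι a} d) {x : P} {a : A} (h : π x = ι a) :
    lineMap π ι l x = Sum.inl fun i => (l.idxFun i).elim x fun f => f.1 a := by
  have h' : ∃ a, π x = ι a := ⟨a, h⟩
  rw [lineMap, dif_pos h', hι (h'.choose_spec.symm.trans h)]

theorem lineMap_of_forall_ne (l : Line {f : A ↪[L] P // ∀ a, π (f a) = ι a} d) {x : P}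
    (h : ¬ ∃ a, π x = ι a) : lineMap π ι l x = Sum.inr (l, x) := by
  rw [lineMap, dif_neg h]

/-- Two lines agree on two points only if the points lie in the same part. -/
theorem eq_of_lineMap_eq (hι : Function.Injective ι)
    {l l' : Line {f : A ↪[L] P // ∀ a, π (f a) = ι a} d} {x y : P}
    (h : lineMap π ι l x = lineMap π ι l' y) : π x = π y := by
  by_cases hx : ∃ a, π x = ι a <;> by_cases hy : ∃ a, π y = ι a
  · obtain ⟨a, ha⟩ := hx
    obtain ⟨b, hb⟩ := hy
    rw [lineMap_of_eq hι l ha, lineMap_of_eq hι l' hb] at h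
    obtain ⟨i, hi⟩ := l.proper
    have h := congrFun (Sum.inl_injective h) i
    simp only [hi, Option.elim_none] at h
    rcases hl' : l'.idxFun i with _ | f
    · simp only [hl', Option.elim_none] at h
      rw [h]
    · simp only [hl', Option.elim_some] at h
      rw [h, f.2, hb]
  · obtain ⟨a, ha⟩ := hx
    rw [lineMap_of_eq hι l ha, lineMap_of_forall_ne l' hy] at h
    cases h
  · obtain ⟨b, hb⟩ := hy
    rw [lineMap_of_eq hι l' hb, lineMap_of_forall_ne l hx] at h
    cases h
  · rw [lineMap_of_forall_ne l hx, lineMap_of_forall_ne l' hy] at h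
    simp only [Sum.inr.injEq, Prod.mk.injEq] at h
    rw [h.2]

theorem eq_of_lineMap_eq_of_none (hι : Function.Injective ι)
    {l l' : Line {f : A ↪[L] P // ∀ a, π (f a) = ι a} d} {x y : P} {i : d}
    (hi : l.idxFun i = none) (hi' : l'.idxFun i = none)
    (h : lineMap π ι l x = lineMap π ι l' y) : x = y := by
  have hxy := eq_of_lineMap_eq hι h
  by_cases hx : ∃ a, π x = ι a
  · obtain ⟨a, ha⟩ := hx
    rw [lineMap_of_eq hι l ha, lineMap_of_eq hι l' (hxy ▸ ha)] at h
    simpa [hi, hi'] using congrFun (Sum.inl_injective h) i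
  · rw [lineMap_of_forall_ne l hx, lineMap_of_forall_ne l' (hxy ▸ hx)] at h
    simp only [Sum.inr.injEq, Prod.mk.injEq] at h
    exact h.2

theorem lineMap_injective (hι : Function.Injective ι)
    (l : Line {f : A ↪[L] P // ∀ a, π (f a) = ι a} d) : Function.Injective (lineMap π ι l) := by
  obtain ⟨i, hi⟩ := l.proper
  exact fun x y h => eq_of_lineMap_eq_of_none hι hi hi h

/-- Lines without a common active coordinate meet only in tuples that lie in copies of `A`, where
the relations are those of `A`. -/
theorem relMap_of_lineMap_eq (hι : Function.Injective ι)
    (l l' : Line {f : A ↪[L] P // ∀ a, π (f a) = ι a} d) (n : ℕ) (R : L.Relations n)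
    (x y : Fin n → P) (hy : Structure.RelMap R y)
    (h : ∀ k, lineMap π ι l (x k) = lineMap π ι l' (y k)) : Structure.RelMap R x := by
  obtain ⟨i, hi⟩ := l.proper
  obtain ⟨i', hi'⟩ := l'.proper
  rcases hl : l'.idxFun i with _ | f
  · rwa [funext fun k => eq_of_lineMap_eq_of_none hι hi hl (h k)]
  rcases hl' : l.idxFun i' with _ | f'
  · rwa [funext fun k => eq_of_lineMap_eq_of_none hι hl' hi' (h k)]
  have hne : l ≠ l' := by
    rintro rfl
    rw [hi] at hl
    cases hl
  have hpart : ∀ k, ∃ a, π (x k) = ι a := by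
    intro k
    by_contra hk
    have hk' : ¬ ∃ a, π (y k) = ι a := eq_of_lineMap_eq hι (h k) ▸ hk
    have := h k
    rw [lineMap_of_forall_ne l hk, lineMap_of_forall_ne l' hk'] at this
    simp only [Sum.inr.injEq, Prod.mk.injEq] at this
    exact hne this.1
  choose a ha using hpart
  have hvec : ∀ k j, (l.idxFun j).elim (x k) (fun f => f.1 (a k)) =
      (l'.idxFun j).elim (y k) fun f => f.1 (a k) := by
    intro k j
    have := h k
    have hy' : π (y k) = ι (a k) := eq_of_lineMap_eq hι this ▸ ha k
    rw [lineMap_of_eq hι l (ha k), lineMap_of_eq hι l' hy'] at this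
    exact congrFun (Sum.inl_injective this) j
  have hx : x = f.1 ∘ a := funext fun k => by simpa [hi, hl] using hvec k i
  have hy' : y = f'.1 ∘ a := funext fun k => by simpa [hi', hl'] using (hvec k i').symm
  rw [hy', StrongHomClass.map_rel] at hy
  rwa [hx, StrongHomClass.map_rel]

variable [L.IsRelational]

/-- One step of the partite construction: the copies of `A` over `ι` are made monochromatic. By the
Hales–Jewett theorem some line in a power of the set of these copies is monochromatic, and the new
structure is the union of the images of `P` under the maps `lineMap` of all lines. -/
theorem exists_partite_step {K : Set (Bundled.{u} L.Structure)} (hfin : ∀ P ∈ K, Finite P)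
    (hK : ClosedUnderCovers K) (A : Bundled.{u} L.Structure) [Finite A]
    (P : Bundled.{u} L.Structure) (hP : P ∈ K) {T : Type*} (π : P → T) (ι : A → T)
    (hι : Function.Injective ι) {r : ℕ} (hr : 0 < r) :
    ∃ P' ∈ K, ∃ π' : P' → T, ∀ χ : (A ↪[L] P') → Fin r, ∃ g : P ↪[L] P',
      (∀ x, π' (g x) = π x) ∧
      ∃ j, ∀ f : A ↪[L] P, (∀ a, π (f a) = ι a) → χ (g.comp f) = j := by
  classical
  have := hfin P hP
  have hAP : Finite (A ↪[L] P) := Finite.of_injective (fun f => (f : A → P)) DFunLike.coe_injective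
  obtain ⟨d, _, hd⟩ := Line.exists_mono_in_high_dimension
    {f : A ↪[L] P // ∀ a, π (f a) = ι a} (Fin r)
  obtain ⟨l₀, -⟩ := hd fun _ => ⟨0, hr⟩
  have : Finite (Line {f : A ↪[L] P // ∀ a, π (f a) = ι a} d) :=
    Finite.of_injective Line.idxFun fun l l' h => Line.ext h
  obtain ⟨g, hg, hcov⟩ := exists_isCover_unionStr P (lineMap π ι (d := d))
    (lineMap_injective hι) (relMap_of_lineMap_eq hι)
  refine ⟨_, hK P hP _ _ g (finite_unionStr P _) ⟨l₀⟩ hcov, fun z => π (exists_unionVal_eq z).choose,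
    fun χ => ?_⟩
  have hval : ∀ (l : Line {f : A ↪[L] P // ∀ a, π (f a) = ι a} d) (f : A ↪[L] P)
      (hf : ∀ a, π (f a) = ι a) (a : A),
      unionVal ((g l).comp f a) = Sum.inl fun i => (l ⟨f, hf⟩ i).1 a := by
    intro l f hf a
    rw [Embedding.comp_apply, hg, lineMap_of_eq hι l (hf a)]
    refine congrArg Sum.inl (funext fun i => ?_)
    rw [Line.apply_def]
    dsimp only
    rcases l.idxFun i with _ | f' <;> rfl
  -- A vector of copies of `A` gets the colour of the copy of `A` formed by its points, if it is one.
  obtain ⟨l, j, hl⟩ := hd fun F =>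
    if h : ∃ f : A ↪[L] unionStr P (lineMap π ι (d := d)),
      ∀ a, unionVal (f a) = Sum.inl fun i => (F i).1 a then
      χ h.choose else ⟨0, hr⟩
  refine ⟨g l, fun x => ?_, j, fun f hf => ?_⟩
  · obtain ⟨l', hl'⟩ := (exists_unionVal_eq (g l x)).choose_spec
    exact eq_of_lineMap_eq hι (hl'.symm.trans (hg l x))
  · have h : ∃ f' : A ↪[L] unionStr P (lineMap π ι (d := d)),
        ∀ a, unionVal (f' a) = Sum.inl fun i => (l ⟨f, hf⟩ i).1 a := ⟨(g l).comp f, hval l f hf⟩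
    refine Eq.trans (congrArg χ ?_) ((dif_pos h).symm.trans (hl ⟨f, hf⟩))
    refine DFunLike.ext _ _ fun a => unionVal_injective ?_
    rw [h.choose_spec, hval l f hf]

/-- The iterated partite construction: the colour of a copy of `A` in the image of `P` depends only
on the map `ι` that it lies over, as long as `ι` belongs to a given finite set. -/
theorem exists_partite {K : Set (Bundled.{u} L.Structure)} (hfin : ∀ P ∈ K, Finite P)
    (hK : ClosedUnderCovers K) (A : Bundled.{u} L.Structure) [Finite A] {T : Type*}
    {S : Set (A → T)} (hS : S.Finite) (hinj : ∀ ι ∈ S, Function.Injective ι) {r : ℕ} (hr : 0 < r)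
    (P : Bundled.{u} L.Structure) (hP : P ∈ K) (π : P → T) :
    ∃ P' ∈ K, ∃ π' : P' → T, ∀ χ : (A ↪[L] P') → Fin r, ∃ g : P ↪[L] P',
      (∀ x, π' (g x) = π x) ∧
      ∀ ι ∈ S, ∃ j, ∀ f : A ↪[L] P, (∀ a, π (f a) = ι a) → χ (g.comp f) = j := by
  induction S, hS using Set.Finite.induction_on with
  | empty => exact ⟨P, hP, π, fun χ => ⟨Embedding.refl L P, fun _ => rfl, by simp⟩⟩
  | @insert ι S _ _ ih =>
    obtain ⟨P₁, hP₁, π₁, h₁⟩ := ih fun ι' h => hinj ι' (Set.mem_insert_of_mem _ h)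
    obtain ⟨P₂, hP₂, π₂, h₂⟩ := exists_partite_step hfin hK A P₁ hP₁ π₁ ι
      (hinj ι (Set.mem_insert _ _)) hr
    refine ⟨P₂, hP₂, π₂, fun χ => ?_⟩
    obtain ⟨g₂, hg₂, j, hj⟩ := h₂ χ
    obtain ⟨g₁, hg₁, h⟩ := h₁ fun f => χ (g₂.comp f)
    refine ⟨g₂.comp g₁, fun x => by rw [Embedding.comp_apply, hg₂, hg₁], ?_⟩
    rintro ι' (rfl | hι')
    · refine ⟨j, fun f hf => ?_⟩
      rw [Embedding.comp_assoc]
      exact hj _ fun a => by rw [Embedding.comp_apply, hg₁, hf]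
    · obtain ⟨j', hj'⟩ := h ι' hι'
      refine ⟨j', fun f hf => ?_⟩
      rw [Embedding.comp_assoc]
      exact hj' f hf

/-- The Ramsey property for linearly ordered structures `A` and `B` in which `B` embeds in a member
of a class closed under covers: the structure `C` carries a map `π` to a chain, and the copy of `B`
can be chosen to be increasing with respect to `π`. -/
theorem exists_ramsey_of_closedUnderCovers {K : Set (Bundled.{u} L.Structure)}
    (hfin : ∀ P ∈ K, Finite P) (hK : ClosedUnderCovers K) (A B : Bundled.{u} L.Structure)
    [Finite A] [LinearOrder A] [LinearOrder B] (P : Bundled.{u} L.Structure) (hP : P ∈ K)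
    (e : B ↪[L] P) {r : ℕ} (hr : 0 < r) :
    ∃ C ∈ K, ∃ (N : ℕ) (π : C → WithBot (Fin N)), ∀ χ : (A ↪[L] C) → Fin r,
      ∃ (g : B ↪[L] C) (j : Fin r), StrictMono (fun b => π (g b)) ∧
        ∀ f : A ↪[L] B, StrictMono f → χ (g.comp f) = j := by
  classical
  have := hfin P hP
  have : Finite B := Finite.of_injective e e.injective
  obtain ⟨N, hN⟩ := exists_homogeneous_strictMono A B hr
  -- One disjoint copy of `P` for each increasing map of `B` into the chain with `N` elements.
  let Λ := {κ : B → Fin N // StrictMono κ}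
  have : Nonempty Λ := by
    obtain ⟨κ, -, hκ, -⟩ := hN fun _ => ⟨0, hr⟩
    exact ⟨⟨κ, hκ⟩⟩
  obtain ⟨g₀, hg₀, hcov⟩ := exists_isCover_unionStr P (fun (κ : Λ) (x : P) => (κ, x))
    (fun κ x y h => (Prod.mk.inj h).2)
    (fun κ κ' n R x y hy h => by rwa [funext fun i => (Prod.mk.inj (h i)).2])
  have hP₀ := hK P hP _ _ g₀ (finite_unionStr P _) inferInstance hcov
  obtain ⟨C, hC, π, hπ⟩ := exists_partite hfin hK A
    (T := WithBot (Fin N)) (S := {ι | ∃ κ : A → Fin N, StrictMono κ ∧ ι = fun a => (κ a : WithBot _)})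
    (Set.toFinite _)
    (by rintro ι ⟨κ, hκ, rfl⟩ a b h; exact hκ.injective (WithBot.coe_injective h)) hr _ hP₀
    (fun z => if h : ∃ b, e b = (unionVal z).2 then ((unionVal z).1.1 h.choose : WithBot (Fin N))
      else ⊥)
  refine ⟨C, hC, N, π, fun χ => ?_⟩
  obtain ⟨g, hg, hχ⟩ := hπ χ
  have hval : ∀ (κ : Λ) (b : B), π (g (g₀ κ (e b))) = (κ.1 b : WithBot (Fin N)) := by
    intro κ b
    have h : ∃ b', e b' = (unionVal (g₀ κ (e b))).2 := ⟨b, by rw [hg₀]⟩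
    rw [hg, dif_pos h]
    have hb : h.choose = b := e.injective (h.choose_spec.trans (by rw [hg₀]))
    rw [hb, hg₀]
  have : Nonempty (Fin r) := ⟨⟨0, hr⟩⟩
  choose! c hc using hχ
  obtain ⟨κ, j, hκ, hj⟩ := hN fun ι => c fun a => (ι a : WithBot (Fin N))
  refine ⟨(g.comp (g₀ ⟨κ, hκ⟩)).comp e, j, fun a b hab => ?_, fun f hf => ?_⟩
  · simp only [Embedding.comp_apply, hval]
    exact WithBot.coe_lt_coe.2 (hκ hab)
  · rw [← hj f hf, Embedding.comp_assoc, Embedding.comp_assoc]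
    refine hc _ ⟨κ ∘ f, hκ.comp hf, rfl⟩ _ fun a => ?_
    rw [← hg]
    exact hval ⟨κ, hκ⟩ (f a)

end Partite

/-! ### Gluing rooted structures to a core -/

section Glue

variable {σ : FirstOrder.Language.{w, v}}

/-- The maps `c` and `φ i` exhibit `G` as the structure obtained from `Q` by gluing each rooted
structure `X i` to the element `a i`, freely except for the identification of its root. The maps
need not be embeddings: a relation between copies of `a i` alone may hold in some of the parts and
not in others. -/
structure IsGlue {Q : Bundled.{u} σ.Structure} {I : Type*} (a : I → Q)
    (X : I → Rooted.{w, v, u} σ) (G : Bundled.{u} σ.Structure) (c : Q → G)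
    (φ : ∀ i, (X i).str → G) : Prop where
  root : ∀ i, φ i (X i).root = c (a i)
  core_injective : Function.Injective c
  ne_core : ∀ i x, x ≠ (X i).root → ∀ q, φ i x ≠ c q
  part_injective : ∀ i x j y, x ≠ (X i).root → y ≠ (X j).root → φ i x = φ j y →
    (⟨i, x⟩ : Σ i, (X i).str) = ⟨j, y⟩
  exists_eq : ∀ g, (∃ q, c q = g) ∨ ∃ i x, φ i x = g
  rel : ∀ {n : ℕ} (R : σ.Relations n) (z : Fin n → G), Structure.RelMap R z ↔
    (∃ q, Structure.RelMap R q ∧ z = c ∘ q) ∨ ∃ i x, Structure.RelMap R x ∧ z = φ i ∘ x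

theorem IsGlue.injective_part {Q : Bundled.{u} σ.Structure} {I : Type*} {a : I → Q}
    {X : I → Rooted.{w, v, u} σ} {G : Bundled.{u} σ.Structure} {c : Q → G}
    {φ : ∀ i, (X i).str → G} (H : IsGlue a X G c φ) (i : I) : Function.Injective (φ i) := by
  intro x y h
  by_cases hx : x = (X i).root <;> by_cases hy : y = (X i).root
  · rw [hx, hy]
  · rw [hx, H.root] at h
    exact absurd h.symm (H.ne_core i y hy _)
  · rw [hy, H.root] at h
    exact absurd h (H.ne_core i x hx _)
  · have := H.part_injective i x i y hx hy h
    rw [Sigma.mk.injEq] at this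
    exact eq_of_heq this.2

/-- Transport of a gluing along isomorphisms of the parts and of the glued structure. -/
theorem IsGlue.congr {Q : Bundled.{u} σ.Structure} {I : Type u} {a : I → Q}
    {X X' : I → Rooted.{w, v, u} σ} {G G' : Bundled.{u} σ.Structure} {c : Q → G}
    {φ : ∀ i, (X i).str → G} (H : IsGlue a X G c φ) (e : G ≃[σ] G')
    (ψ : ∀ i, (X' i).str ≃[σ] (X i).str) (hψ : ∀ i, ψ i (X' i).root = (X i).root) :
    IsGlue a X' G' (e ∘ c) (fun i x => e (φ i (ψ i x))) where
  root := fun i => by rw [hψ, H.root, Function.comp_apply]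
  core_injective := e.injective.comp H.core_injective
  ne_core := fun i x hx q h =>
    H.ne_core i _ (fun hr => hx ((ψ i).injective (hr.trans (hψ i).symm))) q (e.injective h)
  part_injective := fun i x j y hx hy h => by
    have h := H.part_injective i _ j _
      (fun hr => hx ((ψ i).injective (hr.trans (hψ i).symm)))
      (fun hr => hy ((ψ j).injective (hr.trans (hψ j).symm))) (e.injective h)
    rw [Sigma.mk.injEq] at h
    obtain ⟨rfl, h⟩ := h
    rw [(ψ i).injective (eq_of_heq h)]
  exists_eq := fun g => by
    rcases H.exists_eq (e.symm g) with ⟨q, h⟩ | ⟨i, x, h⟩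
    · exact Or.inl ⟨q, by rw [Function.comp_apply, h, e.apply_symm_apply]⟩
    · refine Or.inr ⟨i, (ψ i).symm x, ?_⟩
      rw [(ψ i).apply_symm_apply, h, e.apply_symm_apply]
  rel := fun {n} R z => by
    have hz : z = e ∘ (e.symm ∘ z) := funext fun k => (e.apply_symm_apply (z k)).symm
    rw [hz, StrongHomClass.map_rel, H.rel]
    have hp : ∀ i (x : Fin n → (X' i).str), (fun y => e (φ i (ψ i y))) ∘ x = e ∘ φ i ∘ ψ i ∘ x :=
      fun _ _ => rfl
    simp only [Function.comp_assoc, hp, e.injective.comp_left.eq_iff]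
    refine or_congr Iff.rfl (exists_congr fun i => ⟨?_, ?_⟩)
    · rintro ⟨x, hx, h⟩
      have hx' : ψ i ∘ ((ψ i).symm ∘ x) = x := funext fun k => (ψ i).apply_symm_apply (x k)
      exact ⟨(ψ i).symm ∘ x, (StrongHomClass.map_rel (ψ i).symm R x).2 hx, by rw [hx', h]⟩
    · rintro ⟨x, hx, h⟩
      exact ⟨ψ i ∘ x, (StrongHomClass.map_rel (ψ i) R x).2 hx, h⟩

variable [σ.IsRelational]

/-- A bijection that preserves and reflects the relations is an isomorphism. -/
theorem exists_equiv_of_bijective {M N : Bundled.{u} σ.Structure} (f : M → N)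
    (hf : Function.Bijective f)
    (hrel : ∀ (n : ℕ) (R : σ.Relations n) (x : Fin n → M),
      Structure.RelMap R (f ∘ x) ↔ Structure.RelMap R x) :
    ∃ e : M ≃[σ] N, ∀ x, e x = f x :=
  ⟨⟨_root_.Equiv.ofBijective f hf, fun g => isEmptyElim g, fun R x => hrel _ R x⟩, fun _ => rfl⟩

section Construction

variable {Q : Bundled.{u} σ.Structure} {I : Type u} (a : I → Q) (X : I → Rooted.{w, v, u} σ)

/-- The element of the glued structure given by an element of a part: its root is identified with
the element of the core that the part is attached to. -/
noncomputable def gluePartAux (i : I) (x : (X i).str) :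
    Q ⊕ Σ i, {x : (X i).str // x ≠ (X i).root} :=
  open Classical in if h : x = (X i).root then Sum.inl (a i) else Sum.inr ⟨i, x, h⟩

/-- The structure obtained from `Q` by gluing each rooted structure `X i` to the element `a i`. -/
def glueStr : Bundled.{u} σ.Structure where
  α := Q ⊕ Σ i, {x : (X i).str // x ≠ (X i).root}
  str :=
    { RelMap := fun R z =>
        (∃ q : Fin _ → Q, Structure.RelMap R q ∧ z = Sum.inl ∘ q) ∨
        ∃ i, ∃ x : Fin _ → (X i).str, Structure.RelMap R x ∧ z = gluePartAux a X i ∘ x }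

/-- The inclusion of the core. -/
def glueCore (q : Q) : glueStr a X := Sum.inl q

/-- The map from a part to the glued structure. -/
noncomputable def gluePart (i : I) (x : (X i).str) : glueStr a X := gluePartAux a X i x

theorem gluePart_root (i : I) : gluePart a X i (X i).root = glueCore a X (a i) :=
  dif_pos rfl

theorem gluePart_of_ne {i : I} {x : (X i).str} (h : x ≠ (X i).root) :
    gluePart a X i x = (Sum.inr ⟨i, x, h⟩ : Q ⊕ Σ i, {x : (X i).str // x ≠ (X i).root}) :=
  dif_neg h

theorem glueStr_isGlue : IsGlue a X (glueStr a X) (glueCore a X) (gluePart a X) where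
  root := gluePart_root a X
  core_injective := fun _ _ h => Sum.inl_injective h
  ne_core := fun i x hx q h => by
    rw [gluePart_of_ne a X hx] at h
    cases h
  part_injective := fun i x j y hx hy h => by
    rw [gluePart_of_ne a X hx, gluePart_of_ne a X hy] at h
    have h := Sum.inr_injective h
    rw [Sigma.mk.injEq] at h
    obtain ⟨rfl, h⟩ := h
    cases eq_of_heq h
    rfl
  exists_eq := by
    rintro (q | ⟨i, x, hx⟩)
    · exact Or.inl ⟨q, rfl⟩
    · exact Or.inr ⟨i, x, gluePart_of_ne a X hx⟩
  rel := fun R z => Iff.rfl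

variable {a X}

/-- The map out of a glued structure given by maps on the core and on the parts. -/
def glueMap {G : Type*} (h : Q → G) (f : ∀ i, (X i).str → G) (z : glueStr a X) : G :=
  Sum.elim h (fun p : Σ i, {x : (X i).str // x ≠ (X i).root} => f p.1 p.2.1) z

theorem glueMap_core {G : Type*} (h : Q → G) (f : ∀ i, (X i).str → G) (q : Q) :
    glueMap h f (glueCore a X q) = h q :=
  rfl

theorem glueMap_part {G : Type*} {h : Q → G} {f : ∀ i, (X i).str → G}
    (hf : ∀ i, f i (X i).root = h (a i)) (i : I) (x : (X i).str) :
    glueMap h f (gluePart a X i x) = f i x := by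
  by_cases hx : x = (X i).root
  · rw [hx, gluePart_root, glueMap_core, hf]
  · rw [gluePart_of_ne a X hx]
    rfl

theorem relMap_glueCore {n : ℕ} (R : σ.Relations n) (x : Fin n → Q) (h : Structure.RelMap R x) :
    Structure.RelMap R (glueCore a X ∘ x) :=
  Or.inl ⟨x, h, rfl⟩

theorem relMap_gluePart (i : I) {n : ℕ} (R : σ.Relations n) (x : Fin n → (X i).str)
    (h : Structure.RelMap R x) : Structure.RelMap R (gluePart a X i ∘ x) :=
  Or.inr ⟨i, x, h, rfl⟩

/-- Homomorphisms on the core and on the parts, compatible at the roots, extend to the glued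
structure. -/
theorem exists_glueHom {P : Bundled.{u} σ.Structure} (h : Q →[σ] P) (f : ∀ i, (X i).str →[σ] P)
    (hf : ∀ i, f i (X i).root = h (a i)) :
    ∃ g : glueStr a X →[σ] P, ∀ q, g (glueCore a X q) = h q := by
  refine ⟨⟨glueMap h fun i => f i, fun g => isEmptyElim g, ?_⟩, fun q => rfl⟩
  rintro n R z (⟨q, hq, rfl⟩ | ⟨i, x, hx, rfl⟩)
  · exact HomClass.map_rel h R q hq
  · convert HomClass.map_rel (f i) R x hx using 1
    exact funext fun k => glueMap_part hf i (x k)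

theorem IsGlue.exists_equiv {G : Bundled.{u} σ.Structure} {c : Q → G} {φ : ∀ i, (X i).str → G}
    (H : IsGlue a X G c φ) :
    ∃ e : glueStr a X ≃[σ] G, (∀ q, e (glueCore a X q) = c q) ∧
      ∀ i x, e (gluePart a X i x) = φ i x := by
  have hpart := glueMap_part (a := a) H.root
  have hinj : Function.Injective (glueMap (a := a) c φ) := by
    rintro (q | ⟨i, x, hx⟩) (q' | ⟨j, y, hy⟩) h
    · exact congrArg Sum.inl (H.core_injective h)
    · exact absurd h.symm (H.ne_core j y hy q)
    · exact absurd h (H.ne_core i x hx q')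
    · have h := H.part_injective i x j y hx hy h
      rw [Sigma.mk.injEq] at h
      obtain ⟨rfl, h⟩ := h
      cases eq_of_heq h
      rfl
  suffices h : ∃ e : glueStr a X ≃[σ] G, ∀ z, e z = glueMap c φ z by
    obtain ⟨e, he⟩ := h
    exact ⟨e, fun q => he _, fun i x => (he _).trans (hpart i x)⟩
  refine exists_equiv_of_bijective _ ⟨hinj, fun g => ?_⟩ ?_
  · rcases H.exists_eq g with ⟨q, rfl⟩ | ⟨i, x, rfl⟩
    · exact ⟨glueCore a X q, rfl⟩
    · exact ⟨gluePart a X i x, hpart i x⟩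
  · intro n R z
    have hc : ∀ q : Fin n → Q, c ∘ q = glueMap (a := a) c φ ∘ glueCore a X ∘ q := fun q => rfl
    have hp : ∀ i (x : Fin n → (X i).str), φ i ∘ x = glueMap c φ ∘ gluePart a X i ∘ x :=
      fun i x => funext fun k => (hpart i (x k)).symm
    simp only [H.rel, (glueStr_isGlue a X).rel, hc, hp, hinj.comp_left.eq_iff]

end Construction

theorem IsGlue.nonempty_equiv {Q : Bundled.{u} σ.Structure} {I : Type u} {a : I → Q}
    {X : I → Rooted.{w, v, u} σ} {G G' : Bundled.{u} σ.Structure} {c : Q → G}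
    {φ : ∀ i, (X i).str → G} {c' : Q → G'} {φ' : ∀ i, (X i).str → G'}
    (H : IsGlue a X G c φ) (H' : IsGlue a X G' c' φ') : Nonempty (G ≃[σ] G') := by
  obtain ⟨e, -⟩ := H.exists_equiv
  obtain ⟨e', -⟩ := H'.exists_equiv
  exact ⟨e'.comp e.symm⟩

end Glue

/-! ### Joins as gluings -/

section Joins

variable {σ : FirstOrder.Language.{w, v}}

/-- A gluing of a single rooted structure `X` to the root of `Y`. -/
abbrev IsJoin (X Y : Rooted.{w, v, u} σ) (G : Bundled.{u} σ.Structure) (i : X.str → G)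
    (j : Y.str → G) : Prop :=
  IsGlue (fun _ : PUnit.{u + 1} => Y.root) (fun _ => X) G j fun _ => i

theorem IsJoin.left_injective {X Y : Rooted.{w, v, u} σ} {G : Bundled.{u} σ.Structure}
    {i : X.str → G} {j : Y.str → G} (H : IsJoin X Y G i j) : Function.Injective i :=
  H.injective_part ⟨⟩

theorem IsJoin.symm {X Y : Rooted.{w, v, u} σ} {G : Bundled.{u} σ.Structure}
    {i : X.str → G} {j : Y.str → G} (H : IsJoin X Y G i j) : IsJoin Y X G j i where
  root := fun _ => (H.root ⟨⟩).symm
  core_injective := H.left_injective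
  ne_core := fun _ y hy x h => by
    by_cases hx : x = X.root
    · have hroot : i X.root = j Y.root := H.root ⟨⟩
      exact hy (H.core_injective (h.trans (hx ▸ hroot)))
    · exact H.ne_core ⟨⟩ x hx y h.symm
  part_injective := fun _ x _ y _ _ h => by rw [H.core_injective h]
  exists_eq := fun g => (H.exists_eq g).elim (fun h => Or.inr ⟨⟨⟩, h⟩) fun ⟨_, h⟩ => Or.inl h
  rel := fun R z => by
    rw [H.rel, or_comm]
    exact ⟨fun h => h.elim (fun ⟨_, h⟩ => Or.inl h) fun h => Or.inr ⟨⟨⟩, h⟩,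
      fun h => h.elim (fun h => Or.inl ⟨⟨⟩, h⟩) fun ⟨_, h⟩ => Or.inr h⟩

/-- Being isomorphic to a member of `𝓕`. -/
def IsoMem (𝓕 : Set (Bundled.{u} σ.Structure)) (G : Bundled.{u} σ.Structure) : Prop :=
  ∃ F ∈ 𝓕, Nonempty (G ≃[σ] F)

variable {𝓕 : Set (Bundled.{u} σ.Structure)}

theorem IsoMem.of_equiv {G G' : Bundled.{u} σ.Structure} (h : IsoMem 𝓕 G)
    (e : Nonempty (G' ≃[σ] G)) : IsoMem 𝓕 G' := by
  obtain ⟨F, hF, ⟨e'⟩⟩ := h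
  obtain ⟨e⟩ := e
  exact ⟨F, hF, ⟨e'.comp e⟩⟩

variable [σ.IsRelational]

theorem join_isJoin (X Y : Rooted.{w, v, u} σ) :
    IsJoin X Y (join X Y) (fun x => Quotient.mk (joinSetoid X.root Y.root) (Sum.inl x))
      (fun y => Quotient.mk (joinSetoid X.root Y.root) (Sum.inr y)) where
  root := fun _ => Quotient.sound (Or.inr (Or.inl ⟨rfl, rfl⟩))
  core_injective := fun x y h => by
    rcases Quotient.exact h with h | ⟨h, -⟩ | ⟨-, h⟩
    · exact Sum.inr_injective h
    · cases h
    · cases h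
  ne_core := fun _ x hx q h => by
    rcases Quotient.exact h with h | ⟨h, -⟩ | ⟨h, -⟩
    · cases h
    · exact hx (Sum.inl_injective h)
    · cases h
  part_injective := fun _ x _ y hx hy h => by
    rcases Quotient.exact h with h | ⟨-, h⟩ | ⟨h, -⟩
    · rw [Sum.inl_injective h]
    · cases h
    · cases h
  exists_eq := by
    rintro ⟨x | y⟩
    · exact Or.inr ⟨⟨⟩, x, rfl⟩
    · exact Or.inl ⟨y, rfl⟩
  rel := fun R z => by
    constructor
    · rintro ⟨_, ⟨x, hx, rfl⟩ | ⟨y, hy, rfl⟩, rfl⟩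
      · exact Or.inr ⟨⟨⟩, x, hx, rfl⟩
      · exact Or.inl ⟨y, hy, rfl⟩
    · rintro (⟨y, hy, rfl⟩ | ⟨-, x, hx, rfl⟩)
      · exact ⟨_, Or.inr ⟨y, hy, rfl⟩, rfl⟩
      · exact ⟨_, Or.inl ⟨x, hx, rfl⟩, rfl⟩

theorem IsJoin.mem_incompatible_iff {X Y : Rooted.{w, v, u} σ} {G : Bundled.{u} σ.Structure}
    {i : X.str → G} {j : Y.str → G} (H : IsJoin X Y G i j) :
    Y ∈ incompatible 𝓕 X ↔ IsoMem 𝓕 G :=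
  ⟨fun h => IsoMem.of_equiv h (H.nonempty_equiv (join_isJoin X Y)),
    fun h => IsoMem.of_equiv h ((join_isJoin X Y).nonempty_equiv H)⟩

theorem incompatible_congr {X X' : Rooted.{w, v, u} σ} (e : X'.str ≃[σ] X.str)
    (he : e X'.root = X.root) : incompatible 𝓕 X = incompatible 𝓕 X' := by
  ext Y
  have H := join_isJoin X Y
  rw [H.mem_incompatible_iff]
  exact (IsJoin.mem_incompatible_iff
    (H.congr (FirstOrder.Language.Equiv.refl σ _) (X' := fun _ => X') (fun _ => e) fun _ => he)).symm

/-- A gluing is the join of one part with the gluing of the remaining parts, which are indexed by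
`s : J → I`. -/
theorem IsGlue.isJoin_of_part {Q : Bundled.{u} σ.Structure} {I J : Type u} {a : I → Q}
    {X : I → Rooted.{w, v, u} σ} {G : Bundled.{u} σ.Structure} {c : Q → G}
    {φ : ∀ i, (X i).str → G} (H : IsGlue a X G c φ) (i₀ : I) (s : J → I)
    (hs : Function.Injective s) (hs₀ : ∀ i, i ≠ i₀ ↔ i ∈ Set.range s) :
    IsJoin (X i₀) ⟨glueStr (a ∘ s) (X ∘ s), glueCore (a ∘ s) (X ∘ s) (a i₀)⟩ G (φ i₀)
      (glueMap c fun j => φ (s j)) := by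
  have hpart := glueMap_part (a := a ∘ s) (X := X ∘ s) (h := c) (f := fun j => φ (s j))
    fun j => H.root (s j)
  refine ⟨fun _ => H.root i₀, ?_, ?_, ?_, ?_, ?_⟩
  · rintro (q | ⟨j, x, hx⟩) (q' | ⟨j', y, hy⟩) h
    · exact congrArg Sum.inl (H.core_injective h)
    · exact absurd h.symm (H.ne_core (s j') y hy q)
    · exact absurd h (H.ne_core (s j) x hx q')
    · have h := H.part_injective (s j) x (s j') y hx hy h
      rw [Sigma.mk.injEq] at h
      obtain ⟨h₁, h⟩ := h
      cases hs h₁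
      cases eq_of_heq h
      rfl
  · rintro - x hx (q | ⟨j, y, hy⟩) h
    · exact H.ne_core i₀ x hx q h
    · have h := H.part_injective i₀ x (s j) y hx hy h
      rw [Sigma.mk.injEq] at h
      exact (hs₀ (s j)).2 ⟨j, rfl⟩ h.1.symm
  · rintro - x - y hx hy h
    have h := H.part_injective i₀ x i₀ y hx hy h
    rw [Sigma.mk.injEq] at h
    rw [eq_of_heq h.2]
  · intro g
    rcases H.exists_eq g with ⟨q, rfl⟩ | ⟨i, x, rfl⟩
    · exact Or.inl ⟨glueCore _ _ q, rfl⟩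
    · by_cases hi : i = i₀
      · subst hi
        exact Or.inr ⟨⟨⟩, x, rfl⟩
      · obtain ⟨j, rfl⟩ := (hs₀ i).1 hi
        exact Or.inl ⟨gluePart (a ∘ s) (X ∘ s) j x, hpart j x⟩
  · intro n R z
    rw [H.rel]
    constructor
    · rintro (⟨q, hq, rfl⟩ | ⟨i, x, hx, rfl⟩)
      · exact Or.inl ⟨_, relMap_glueCore R q hq, rfl⟩
      · by_cases hi : i = i₀
        · subst hi
          exact Or.inr ⟨⟨⟩, x, hx, rfl⟩
        · obtain ⟨j, rfl⟩ := (hs₀ i).1 hi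
          exact Or.inl ⟨_, relMap_gluePart (a := a ∘ s) (X := X ∘ s) j R x hx,
            funext fun k => (hpart j (x k)).symm⟩
    · rintro (⟨y, ⟨q, hq, rfl⟩ | ⟨j, x, hx, rfl⟩, rfl⟩ | ⟨-, x, hx, rfl⟩)
      · exact Or.inl ⟨q, hq, rfl⟩
      · exact Or.inr ⟨s j, x, hx, funext fun k => hpart j (x k)⟩
      · exact Or.inr ⟨i₀, x, hx, rfl⟩

/-- Replacing parts of a gluing by equivalent ones does not affect membership in `𝓕`. -/
theorem isoMem_glueStr_congr {Q : Bundled.{u} σ.Structure} {I : Type u} [Finite I] (a : I → Q)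
    (X X' : I → Rooted.{w, v, u} σ) (hX : ∀ i, incompatible 𝓕 (X i) = incompatible 𝓕 (X' i)) :
    IsoMem 𝓕 (glueStr a X) ↔ IsoMem 𝓕 (glueStr a X') := by
  classical
  have := Fintype.ofFinite I
  suffices h : ∀ s : Finset I, IsoMem 𝓕 (glueStr a X) ↔
      IsoMem 𝓕 (glueStr a fun i => if i ∈ s then X' i else X i) by
    simpa using h Finset.univ
  intro s
  induction s using Finset.induction_on with
  | empty => simp
  | insert i₀ s hi₀ ih =>
    rw [ih]
    -- Both gluings have the same remaining parts.
    have hrest : (fun i => if i ∈ s then X' i else X i) ∘ (Subtype.val : {i // i ≠ i₀} → I) =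
        (fun i => if i ∈ insert i₀ s then X' i else X i) ∘ Subtype.val :=
      funext fun i => by simp [i.2]
    have h₁ := (glueStr_isGlue a fun i => if i ∈ s then X' i else X i).isJoin_of_part i₀
      (Subtype.val : {i // i ≠ i₀} → I) Subtype.val_injective (by simp)
    have h₂ := (glueStr_isGlue a fun i => if i ∈ insert i₀ s then X' i else X i).isJoin_of_part i₀
      (Subtype.val : {i // i ≠ i₀} → I) Subtype.val_injective (by simp)
    have h₃ := h₁.mem_incompatible_iff (𝓕 := 𝓕)
    rw [hrest] at h₃
    rw [← h₃, ← h₂.mem_incompatible_iff]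
    simp [hi₀, hX]

/-- Replacing parts of a gluing, rooted in its core, by equivalent ones gives an equivalent rooted
structure. -/
theorem incompatible_glueStr_congr {Q : Bundled.{u} σ.Structure} {I : Type u} [Finite I]
    (a : I → Q) (X X' : I → Rooted.{w, v, u} σ)
    (hX : ∀ i, incompatible 𝓕 (X i) = incompatible 𝓕 (X' i)) (m : Q) :
    incompatible 𝓕 ⟨glueStr a X, glueCore a X m⟩ =
      incompatible 𝓕 ⟨glueStr a X', glueCore a X' m⟩ := by
  ext Y
  -- The join with `Y` is a gluing in which `Y` is one more part.
  have h : ∀ X : I → Rooted.{w, v, u} σ,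
      Y ∈ incompatible 𝓕 ⟨glueStr a X, glueCore a X m⟩ ↔
        IsoMem 𝓕 (glueStr (fun o : Option I => o.elim m a) fun o => o.elim Y X) := fun X =>
    IsJoin.mem_incompatible_iff (IsJoin.symm
      ((glueStr_isGlue (fun o : Option I => o.elim m a) fun o => o.elim Y X).isJoin_of_part none
        some (Option.some_injective I) fun i => by cases i <;> simp))
  rw [h, h]
  refine isoMem_glueStr_congr _ _ _ fun o => ?_
  cases o with
  | none => rfl
  | some i => exact hX i

end Joins

/-! ### Components of a tree with a vertex deleted -/

section Components

variable {σ : FirstOrder.Language.{w, v}} {F : Bundled.{u} σ.Structure}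

theorem incGraph_adj_iff {p q : F ⊕ RelTuple F} : (incGraph F).Adj p q ↔
    ∃ (a : F) (t : RelTuple F), a ∈ Set.range t.val ∧
      (p = Sum.inl a ∧ q = Sum.inr t ∨ p = Sum.inr t ∧ q = Sum.inl a) := by
  rw [incGraph, SimpleGraph.fromRel_adj]
  rcases p with a | t <;> rcases q with b | s <;> simp

theorem gaifman_preconnected (hF : (incGraph F).Connected) : (gaifman F).Preconnected := by
  intro v w
  have h := (SimpleGraph.reachable_iff_reflTransGen _ _).1 (hF.preconnected (Sum.inl v) (Sum.inl w))
  have key : ∀ n : F ⊕ RelTuple F, Relation.ReflTransGen (incGraph F).Adj (Sum.inl v) n →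
      Sum.elim (fun w => (gaifman F).Reachable v w)
        (fun t : RelTuple F => ∀ w ∈ Set.range t.val, (gaifman F).Reachable v w) n := by
    intro n hn
    induction hn with
    | refl => exact SimpleGraph.Reachable.refl _
    | tail _ hadj ih =>
      obtain ⟨a, t, ha, ⟨rfl, rfl⟩ | ⟨rfl, rfl⟩⟩ := incGraph_adj_iff.1 hadj
      · intro w hw
        by_cases haw : a = w
        · exact haw ▸ ih
        · exact SimpleGraph.Reachable.trans ih
            (SimpleGraph.Adj.reachable (G := gaifman F) ⟨haw, t, ha, hw⟩)
      · exact ih a ha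
  exact key _ h

/-- In a tree, every element outside a tuple `t` is separated from the rest of `t` by the element of
`t` at which the path of the incidence graph from it enters `t`. -/
theorem exists_separating_mem (hF : (incGraph F).IsTree) (t : RelTuple F) {v : F}
    (hv : v ∉ Set.range t.val) : ∃ y ∈ Set.range t.val, ∃ hvy : v ≠ y,
      ∀ w ∈ Set.range t.val, ∀ hw : w ≠ y,
        ¬ (gaifmanDelete F y).Reachable ⟨v, hvy⟩ ⟨w, hw⟩ := by
  classical
  obtain ⟨p, hp⟩ := (hF.1.preconnected (Sum.inl v) (Sum.inr t)).exists_isPath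
  have hnil : ¬ p.Nil := SimpleGraph.Walk.not_nil_of_ne (by simp)
  obtain ⟨y, s, hy, ⟨hpen, hs⟩ | ⟨-, hs⟩⟩ := incGraph_adj_iff.1 (p.adj_penultimate hnil)
  swap
  · cases hs
  cases hs
  have hyp : Sum.inl y ∈ p.support := hpen ▸ p.getVert_mem_support _
  refine ⟨y, hy, fun h => hv (h ▸ hy), fun w hw hwy hreach => ?_⟩
  have key : ∀ z : ({y}ᶜ : Set F),
      Relation.ReflTransGen (gaifmanDelete F y).Adj ⟨v, fun h => hv (h ▸ hy)⟩ z →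
      ∃ q : (incGraph F).Walk (Sum.inl v) (Sum.inl z.1), Sum.inl y ∉ q.support := by
    intro z hz
    induction hz with
    | refl =>
      refine ⟨SimpleGraph.Walk.nil, ?_⟩
      rw [SimpleGraph.Walk.support_nil, List.mem_singleton, Sum.inl.injEq]
      exact fun h => hv (h ▸ hy)
    | @tail a b _ hadj ih =>
      obtain ⟨q, hq⟩ := ih
      obtain ⟨-, u, ha, hb⟩ := hadj
      have h₁ : (incGraph F).Adj (Sum.inl a.1) (Sum.inr u) :=
        incGraph_adj_iff.2 ⟨_, _, ha, Or.inl ⟨rfl, rfl⟩⟩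
      have h₂ : (incGraph F).Adj (Sum.inr u) (Sum.inl b.1) :=
        incGraph_adj_iff.2 ⟨_, _, hb, Or.inr ⟨rfl, rfl⟩⟩
      refine ⟨(q.concat h₁).concat h₂, ?_⟩
      simp only [SimpleGraph.Walk.support_concat, List.mem_append, List.mem_singleton,
        Sum.inl.injEq, reduceCtorEq, or_false, hq, false_or]
      exact fun h => b.2 h.symm
  obtain ⟨q, hq⟩ := key _ ((SimpleGraph.reachable_iff_reflTransGen _ _).1 hreach)
  have h₁ : (incGraph F).Adj (Sum.inl w) (Sum.inr t) :=
    incGraph_adj_iff.2 ⟨_, _, hw, Or.inl ⟨rfl, rfl⟩⟩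
  have hq' : Sum.inl y ∉ (q.concat h₁).bypass.support := by
    intro h
    have h := SimpleGraph.Walk.support_bypass_subset_support _ h
    simp only [SimpleGraph.Walk.support_concat, List.mem_append, List.mem_singleton,
      reduceCtorEq, or_false] at h
    exact hq h
  have huniq : p = (q.concat h₁).bypass := congrArg Subtype.val
    ((hF.isAcyclic.subsingleton_path _ _).elim ⟨p, hp⟩ ⟨_, (q.concat h₁).bypass_isPath⟩)
  exact hq' (huniq ▸ hyp)

theorem gaifman_adj_of_hom {G H : Bundled.{u} σ.Structure} {f : G → H}
    (hf : ∀ (n : ℕ) (R : σ.Relations n) (x : Fin n → G), Structure.RelMap R x →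
      Structure.RelMap R (f ∘ x)) (hinj : Function.Injective f) {x y : G}
    (h : (gaifman G).Adj x y) : (gaifman H).Adj (f x) (f y) := by
  obtain ⟨hne, t, ⟨i, hi⟩, ⟨j, hj⟩⟩ := h
  exact ⟨hinj.ne hne, ⟨t.arity, t.rel, f ∘ t.val, hf _ _ _ t.holds⟩, ⟨i, congrArg f hi⟩,
    ⟨j, congrArg f hj⟩⟩

/-- The elements of a connected component of the Gaifman graph with a vertex deleted. -/
def compSet {y : F} (E : (gaifmanDelete F y).ConnectedComponent) : Set F :=
  Subtype.val '' E.supp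

variable {y : F} {E : (gaifmanDelete F y).ConnectedComponent}

theorem mem_compSet_iff {v : F} :
    v ∈ compSet E ↔ ∃ h : v ≠ y, (gaifmanDelete F y).connectedComponentMk ⟨v, h⟩ = E :=
  ⟨fun ⟨x, hx, h⟩ => h ▸ ⟨x.2, hx⟩, fun ⟨h, hE⟩ => ⟨⟨v, h⟩, hE, rfl⟩⟩

theorem ne_of_mem_compSet {v : F} (h : v ∈ compSet E) : v ≠ y :=
  (mem_compSet_iff.1 h).1

theorem compSet_nonempty : (compSet E).Nonempty := by
  obtain ⟨x, rfl⟩ := E.exists_rep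
  exact ⟨x, x, rfl, rfl⟩

theorem mem_compSet_iff_reachable {v w : F} (hv : v ∈ compSet E) (hw : w ≠ y) :
    w ∈ compSet E ↔ (gaifmanDelete F y).Reachable ⟨w, hw⟩ ⟨v, ne_of_mem_compSet hv⟩ := by
  obtain ⟨h, rfl⟩ := mem_compSet_iff.1 hv
  rw [mem_compSet_iff, ← SimpleGraph.ConnectedComponent.eq]
  exact ⟨fun h => h.2, fun h => ⟨hw, h⟩⟩

theorem mem_compSet_of_adj {v w : F} (hv : v ∈ compSet E) (h : (gaifman F).Adj v w)
    (hw : w ≠ y) : w ∈ compSet E :=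
  (mem_compSet_iff_reachable hv hw).2 (SimpleGraph.Adj.reachable h.symm)

/-- A tuple that meets a component is contained in the component and the deleted vertex. -/
theorem mem_insert_compSet_of_mem_range {t : RelTuple F} {v w : F} (hv : v ∈ compSet E)
    (hvt : v ∈ Set.range t.val) (hwt : w ∈ Set.range t.val) : w ∈ insert y (compSet E) := by
  by_cases hw : w = y
  · exact Or.inl hw
  · by_cases hvw : v = w
    · exact Or.inr (hvw ▸ hv)
    · exact Or.inr (mem_compSet_of_adj hv ⟨hvw, t, hvt, hwt⟩ hw)

theorem exists_adj_of_preconnected (hF : (gaifman F).Preconnected)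
    (E : (gaifmanDelete F y).ConnectedComponent) : ∃ v ∈ compSet E, (gaifman F).Adj v y := by
  by_contra! hcon
  obtain ⟨v, hv⟩ := compSet_nonempty (E := E)
  have key : ∀ w, Relation.ReflTransGen (gaifman F).Adj v w → w ∈ compSet E := by
    intro w hw
    induction hw with
    | refl => exact hv
    | tail _ hadj ih => exact mem_compSet_of_adj ih hadj fun h => hcon _ ih (h ▸ hadj)
  exact ne_of_mem_compSet (key y ((SimpleGraph.reachable_iff_reflTransGen _ _).1 (hF v y))) rfl

/-- A property of the deleted vertex that passes to neighbours within the component holds throughout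
the component. -/
theorem compSet_induction (hF : (gaifman F).Preconnected) {P : F → Prop} (hy : P y)
    (hP : ∀ v ∈ compSet E, ∀ w ∈ insert y (compSet E), (gaifman F).Adj v w → P w → P v)
    {v : F} (hv : v ∈ compSet E) : P v := by
  obtain ⟨v₀, hv₀, hadj⟩ := exists_adj_of_preconnected hF E
  have h := (mem_compSet_iff_reachable hv₀ (ne_of_mem_compSet hv)).1 hv
  have key : ∀ z : ({y}ᶜ : Set F), Relation.ReflTransGen (gaifmanDelete F y).Adj
      ⟨v₀, ne_of_mem_compSet hv₀⟩ z → z.1 ∈ compSet E ∧ P z.1 := by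
    intro z hz
    induction hz with
    | refl => exact ⟨hv₀, hP _ hv₀ _ (Or.inl rfl) hadj hy⟩
    | @tail a b _ hab ih =>
      have hb : b.1 ∈ compSet E := mem_compSet_of_adj ih.1 hab b.2
      exact ⟨hb, hP _ hb _ (Or.inr ih.1) (SimpleGraph.Adj.symm hab) ih.2⟩
  exact (key _ ((SimpleGraph.reachable_iff_reflTransGen _ _).1 h.symm)).2

/-- The elements of a component of `F` without `y` reach `y` outside every vertex `y'` not in the
component. -/
theorem reachable_of_notMem_compSet (hF : (gaifman F).Preconnected) {y' : F} (hy : y ≠ y')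
    (hy' : y' ∉ compSet E) {v : F} (hv : v ∈ compSet E) (hvy' : v ≠ y') :
    (gaifmanDelete F y').Reachable ⟨v, hvy'⟩ ⟨y, hy⟩ := by
  refine compSet_induction (P := fun v => ∀ h : v ≠ y', (gaifmanDelete F y').Reachable ⟨v, h⟩
    ⟨y, hy⟩) hF (fun _ => SimpleGraph.Reachable.refl _) (fun v _ w hw hadj ih h => ?_) hv hvy'
  have hwy' : w ≠ y' := by
    rintro rfl
    exact hw.elim (fun h => hy h.symm) hy'
  exact SimpleGraph.Reachable.trans
    (SimpleGraph.Adj.reachable (G := gaifmanDelete F y') (u := ⟨v, h⟩) (v := ⟨w, hwy'⟩) hadj)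
    (ih hwy')

end Components

/-! ### Induced substructures and pieces -/

section InducedPieces

variable {σ : FirstOrder.Language.{w, v}} {𝓕 : Set (Bundled.{u} σ.Structure)}

theorem Piece.domain_eq (p : Piece 𝓕) : p.domain = insert p.cut (compSet p.component) :=
  rfl

variable [σ.IsRelational]

/-- The inclusion of an induced substructure. -/
def inducedVal {A : Bundled.{u} σ.Structure} {S : Set A} (x : induced A S) : A :=
  Subtype.val x

/-- An element of an induced substructure. -/
def inducedMk {A : Bundled.{u} σ.Structure} {S : Set A} (x : A) (h : x ∈ S) : induced A S :=
  Subtype.mk x h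

variable {A : Bundled.{u} σ.Structure} {S : Set A}

theorem inducedVal_mem (x : induced A S) : inducedVal x ∈ S :=
  Subtype.property x

theorem inducedVal_injective : Function.Injective (inducedVal (A := A) (S := S)) :=
  Subtype.val_injective

theorem inducedMk_injective {x y : A} {hx : x ∈ S} {hy : y ∈ S}
    (h : inducedMk x hx = inducedMk y hy) : x = y :=
  congrArg inducedVal h

theorem Piece.mem_compSet_of_ne (p : Piece 𝓕) {x : p.rooted.str} (hx : x ≠ p.rooted.root) :
    inducedVal (A := p.tree) (S := p.domain) x ∈ compSet p.component :=
  (inducedVal_mem (A := p.tree) (S := p.domain) x).resolve_left fun h => hx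
    (inducedVal_injective (A := p.tree) (S := p.domain) h)

theorem Piece.gaifman_preconnected (p : Piece 𝓕) (hp : (gaifman p.tree).Preconnected) :
    (gaifman p.rooted.str).Preconnected := by
  suffices h : ∀ x : p.rooted.str, (gaifman p.rooted.str).Reachable x p.rooted.root from
    fun x y => (h x).trans (h y).symm
  intro x
  by_cases hx : x = p.rooted.root
  · rw [hx]
  refine compSet_induction (P := fun v => ∀ h : v ∈ p.domain, (gaifman p.rooted.str).Reachable
    (inducedMk v h) p.rooted.root) hp (fun _ => SimpleGraph.Reachable.refl _)
    (fun v hv w hw hadj ih h => ?_) (p.mem_compSet_of_ne hx) (inducedVal_mem _)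
  refine SimpleGraph.Reachable.trans (SimpleGraph.Adj.reachable (G := gaifman p.rooted.str) ?_)
    (ih hw)
  obtain ⟨hne, t, hvt, hwt⟩ := hadj
  have ht : ∀ i, t.val i ∈ p.domain := fun i => mem_insert_compSet_of_mem_range hv hvt ⟨i, rfl⟩
  refine ⟨fun h => hne (inducedMk_injective h), ⟨t.arity, t.rel, fun i => inducedMk _ (ht i),
    t.holds⟩, ?_, ?_⟩
  · obtain ⟨i, hi⟩ := hvt
    exact ⟨i, inducedVal_injective (A := p.tree) (S := p.domain) hi⟩
  · obtain ⟨i, hi⟩ := hwt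
    exact ⟨i, inducedVal_injective (A := p.tree) (S := p.domain) hi⟩

/-- The other side of a piece: the substructure induced by the complement of its component, with the
cut as its root. -/
def Piece.rest (p : Piece 𝓕) : Rooted.{w, v, u} σ where
  str := induced p.tree (compSet p.component)ᶜ
  root := inducedMk p.cut fun h => ne_of_mem_compSet h rfl

theorem Piece.isJoin_rest (p : Piece 𝓕) :
    IsJoin p.rooted p.rest p.tree (inducedVal (A := p.tree) (S := p.domain))
      (inducedVal (A := p.tree) (S := (compSet p.component)ᶜ)) where
  root := fun _ => rfl
  core_injective := inducedVal_injective
  ne_core := fun _ _ hx q h => inducedVal_mem q (h ▸ p.mem_compSet_of_ne hx)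
  part_injective := fun _ x _ y _ _ h => by
    rw [inducedVal_injective (A := p.tree) (S := p.domain) h]
  exists_eq := fun g => by
    by_cases hg : g ∈ compSet p.component
    · exact Or.inr ⟨⟨⟩, inducedMk (S := p.domain) g (Or.inr hg), rfl⟩
    · exact Or.inl ⟨inducedMk g hg, rfl⟩
  rel := fun R z => by
    constructor
    · intro hR
      by_cases hz : ∃ k, z k ∈ compSet p.component
      · obtain ⟨k, hk⟩ := hz
        have ht : ∀ i, z i ∈ p.domain := fun i =>
          mem_insert_compSet_of_mem_range (t := ⟨_, R, z, hR⟩) hk ⟨k, rfl⟩ ⟨i, rfl⟩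
        exact Or.inr ⟨⟨⟩, fun i => inducedMk (z i) (ht i), hR, rfl⟩
      · exact Or.inl ⟨fun i => inducedMk (z i) fun h => hz ⟨i, h⟩, hR, rfl⟩
    · rintro (⟨q, hq, rfl⟩ | ⟨-, x, hx, rfl⟩)
      · exact hq
      · exact hx

theorem Piece.exists_ne_root_rest (p : Piece 𝓕) : ∃ x : p.rest.str, x ≠ p.rest.root := by
  by_contra! hcon
  refine p.isCut fun x y => ?_
  have h : ∀ x : ({p.cut}ᶜ : Set p.tree), x.1 ∈ compSet p.component := by
    intro x
    by_contra hx
    exact x.2 (congrArg inducedVal (hcon (inducedMk (S := (compSet p.component)ᶜ) x.1 hx)))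
  exact (mem_compSet_iff_reachable (h y) x.2).1 (h x)

/-- A rooted structure is a piece if some join of it is in `𝓕`, provided that it stays connected and
nonempty without its root, that the other side has further elements, and that it contains all the
relations between copies of the root. -/
theorem exists_piece_of_isJoin {X Y : Rooted.{w, v, u} σ} {F : Bundled.{u} σ.Structure}
    {f : X.str → F} {g : Y.str → F} (H : IsJoin X Y F f g) (hF : F ∈ 𝓕)
    (hconn : (gaifmanDelete X.str X.root).Preconnected) (hX : ∃ x, x ≠ X.root)
    (hY : ∃ y, y ≠ Y.root)
    (hconst : ∀ (n : ℕ) (R : σ.Relations n), Structure.RelMap R (fun _ : Fin n => Y.root) →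
      Structure.RelMap R (fun _ : Fin n => X.root)) :
    ∃ (p : Piece 𝓕) (e : X.str ≃[σ] p.rooted.str), e X.root = p.rooted.root := by
  have hf : Function.Injective f := H.left_injective
  have hroot : f X.root = g Y.root := H.root ⟨⟩
  have hfrel : ∀ (n : ℕ) (R : σ.Relations n) (x : Fin n → X.str), Structure.RelMap R x →
      Structure.RelMap R (f ∘ x) := fun n R x hx => (H.rel R _).2 (Or.inr ⟨⟨⟩, x, hx, rfl⟩)
  have hne : ∀ x, x ≠ X.root → f x ≠ f X.root := fun x hx h => hx (hf h)
  obtain ⟨x₀, hx₀⟩ := hX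
  let E := (gaifmanDelete F (f X.root)).connectedComponentMk ⟨f x₀, hne x₀ hx₀⟩
  have hx₀E : f x₀ ∈ compSet E := mem_compSet_iff.2 ⟨_, rfl⟩
  have hE : ∀ v, v ∈ compSet E ↔ ∃ x, x ≠ X.root ∧ f x = v := by
    intro v
    constructor
    · intro hv
      have key : ∀ z : ({f X.root}ᶜ : Set F), Relation.ReflTransGen
          (gaifmanDelete F (f X.root)).Adj ⟨f x₀, hne x₀ hx₀⟩ z → ∃ x, x ≠ X.root ∧ f x = z.1 := by
        intro z hz
        induction hz with
        | refl => exact ⟨x₀, hx₀, rfl⟩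
        | @tail a b _ hab ih =>
          obtain ⟨x, hx, hxa⟩ := ih
          obtain ⟨-, t, ⟨i, hi⟩, ⟨j, hj⟩⟩ := hab
          have hi : t.val i = f x := hi.trans hxa.symm
          rcases (H.rel _ _).1 t.holds with ⟨q, -, hq⟩ | ⟨-, y, -, hy⟩
          · exact absurd (hi.symm.trans (congrFun hq i)) (H.ne_core ⟨⟩ x hx _)
          · have hyb : f (y j) = b.1 := (congrFun hy j).symm.trans hj
            exact ⟨y j, fun h => b.2 (by rw [← hyb, h]; rfl), hyb⟩
      exact key ⟨v, ne_of_mem_compSet hv⟩ ((SimpleGraph.reachable_iff_reflTransGen _ _).1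
        ((mem_compSet_iff_reachable hx₀E (ne_of_mem_compSet hv)).1 hv).symm)
    · rintro ⟨x, hx, rfl⟩
      rw [mem_compSet_iff_reachable hx₀E (hne x hx)]
      let φ : gaifmanDelete X.str X.root →g gaifmanDelete F (f X.root) :=
        ⟨fun z => ⟨f z.1, hne z.1 z.2⟩, fun h => gaifman_adj_of_hom hfrel hf h⟩
      exact (hconn ⟨x, hx⟩ ⟨x₀, hx₀⟩).map φ
  obtain ⟨y₀, hy₀⟩ := hY
  have hcut : IsCut F (f X.root) := by
    intro h
    have hy₀' : g y₀ ≠ f X.root := fun h => hy₀ (H.core_injective (h.trans hroot))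
    obtain ⟨x, hx, hxy⟩ := (hE _).1 ((mem_compSet_iff_reachable hx₀E hy₀').2 (h _ _))
    exact H.ne_core ⟨⟩ x hx _ hxy
  let p : Piece 𝓕 := ⟨F, hF, f X.root, hcut, E⟩
  have hdom : ∀ v, v ∈ p.domain ↔ ∃ x, f x = v := by
    intro v
    rw [Piece.domain_eq, Set.mem_insert_iff, hE]
    constructor
    · rintro (rfl | ⟨x, -, h⟩)
      · exact ⟨_, rfl⟩
      · exact ⟨x, h⟩
    · rintro ⟨x, rfl⟩
      by_cases hx : x = X.root
      · exact Or.inl (congrArg f hx)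
      · exact Or.inr ⟨x, hx, rfl⟩
  have hreflect : ∀ (n : ℕ) (R : σ.Relations n) (x : Fin n → X.str),
      Structure.RelMap R (f ∘ x) → Structure.RelMap R x := by
    intro n R x h
    rcases (H.rel R (f ∘ x)).1 h with ⟨q, hq, hxq⟩ | ⟨-, y, hy, hxy⟩
    -- A tuple of the other side that lies in the image of `X` is constant.
    · have hx : x = fun _ => X.root := by
        funext k
        by_contra hk
        exact H.ne_core ⟨⟩ (x k) hk _ (congrFun hxq k)
      have hq' : q = fun _ => Y.root := by
        funext k
        exact H.core_injective ((congrFun hxq k).symm.trans (by rw [hx]; exact hroot))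
      rw [hx]
      exact hconst n R (hq' ▸ hq)
    · rwa [hf.comp_left hxy]
  obtain ⟨e, he⟩ := exists_equiv_of_bijective (M := X.str) (N := p.rooted.str)
    (fun x => inducedMk (A := F) (f x) ((hdom _).2 ⟨x, rfl⟩))
    ⟨fun x y h => hf (inducedMk_injective h), fun z => by
      obtain ⟨x, hx⟩ := (hdom _).1 (inducedVal_mem (A := F) (S := p.domain) z)
      exact ⟨x, inducedVal_injective (A := F) (S := p.domain) hx⟩⟩
    (fun n R x => ⟨hreflect n R x, hfrel n R x⟩)
  exact ⟨p, e, he _⟩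

end InducedPieces

/-! ### The decomposition of a tree along a tuple -/

section Branches

variable {σ : FirstOrder.Language.{w, v}} {F : Bundled.{u} σ.Structure}

/-- A branch hanging off a set `T` within a set `S`: an element of `T` and a component of the rest of
`F` that avoids `T` and is contained in `S`. -/
structure Branch (F : Bundled.{u} σ.Structure) (T S : Set F) where
  cut : F
  cut_mem : cut ∈ T
  comp : (gaifmanDelete F cut).ConnectedComponent
  notMem : ∀ v ∈ compSet comp, v ∉ T
  subset : compSet comp ⊆ S

instance [Finite F] (T S : Set F) : Finite (Branch F T S) := by
  have h : ∀ y : F, Finite (gaifmanDelete F y).ConnectedComponent := fun y =>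
    Finite.of_surjective _ (Quot.mk_surjective (r := (gaifmanDelete F y).Reachable))
  refine Finite.of_injective
    (fun b : Branch F T S => (⟨b.cut, b.comp⟩ : Σ y, (gaifmanDelete F y).ConnectedComponent)) ?_
  rintro ⟨y, hy, E, h₁, h₂⟩ ⟨y', hy', E', h₁', h₂'⟩ h
  rw [Sigma.mk.injEq] at h
  obtain ⟨rfl, h⟩ := h
  cases eq_of_heq h
  rfl

variable {𝓕 : Set (Bundled.{u} σ.Structure)} {T S : Set F}

/-- A branch at a set with at least two elements, as a piece. -/
def Branch.toPiece (hF : F ∈ 𝓕) (hT : T.Nontrivial) (b : Branch F T S) : Piece 𝓕 where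
  tree := F
  mem := hF
  cut := b.cut
  isCut := fun h => by
    obtain ⟨w, hw, hne⟩ := hT.exists_ne b.cut
    obtain ⟨v, hv⟩ := compSet_nonempty (E := b.comp)
    exact b.notMem w ((mem_compSet_iff_reachable hv hne).2 (h _ _)) hw
  component := b.comp

theorem Branch.domain_subset (hF : F ∈ 𝓕) (hT : T.Nontrivial) (hTS : T ⊆ S) (b : Branch F T S)
    {v : F} (hv : v ∈ (b.toPiece hF hT).domain) : v ∈ S := by
  rcases hv with rfl | hv
  · exact hTS b.cut_mem
  · exact b.subset hv

/-- Distinct branches are disjoint. -/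
theorem Branch.eq_of_mem (hF : (gaifman F).Preconnected) {b b' : Branch F T S} {v : F}
    (hv : v ∈ compSet b.comp) (hv' : v ∈ compSet b'.comp) : b = b' := by
  by_cases h : b.cut = b'.cut
  · obtain ⟨y, hy, E, h₁, h₂⟩ := b
    obtain ⟨y', hy', E', h₁', h₂'⟩ := b'
    cases h
    obtain ⟨_, h⟩ := mem_compSet_iff.1 hv
    obtain ⟨_, h'⟩ := mem_compSet_iff.1 hv'
    cases h.symm.trans h'
    rfl
  · have hr := reachable_of_notMem_compSet hF h (fun h => b.notMem _ h b'.cut_mem) hv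
      (ne_of_mem_compSet hv')
    exact absurd b.cut_mem (b'.notMem _ ((mem_compSet_iff_reachable hv' h).2 hr.symm))

theorem exists_branch (hF : (incGraph F).IsTree) (t : RelTuple F)
    (hS : ∀ y ∈ Set.range t.val, ∀ E : (gaifmanDelete F y).ConnectedComponent,
      (∀ v ∈ compSet E, v ∉ Set.range t.val) → ∀ v ∈ compSet E, v ∈ S → compSet E ⊆ S)
    {v : F} (hv : v ∈ S) (hvt : v ∉ Set.range t.val) :
    ∃ b : Branch F (Set.range t.val) S, v ∈ compSet b.comp := by
  obtain ⟨y, hy, hvy, hsep⟩ := exists_separating_mem hF t hvt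
  have hvE : v ∈ compSet ((gaifmanDelete F y).connectedComponentMk ⟨v, hvy⟩) :=
    mem_compSet_iff.2 ⟨hvy, rfl⟩
  have hE : ∀ w ∈ compSet ((gaifmanDelete F y).connectedComponentMk ⟨v, hvy⟩),
      w ∉ Set.range t.val := fun w hw hwt => hsep w hwt (ne_of_mem_compSet hw)
    ((mem_compSet_iff_reachable hvE (ne_of_mem_compSet hw)).1 hw).symm
  exact ⟨⟨y, hy, _, hE, hS y hy _ hE v hvE hv⟩, hvE⟩

variable [σ.IsRelational]

/-- The substructure of a tree induced by a set `S` containing a tuple `t` is the gluing of the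
branches within `S` to the substructure induced by `t`, if every branch that meets `S` is contained
in `S`. -/
theorem branch_isGlue (hmem : F ∈ 𝓕) (hF : (incGraph F).IsTree) (t : RelTuple F)
    (ht : (Set.range t.val).Nontrivial) (htS : Set.range t.val ⊆ S)
    (hS : ∀ y ∈ Set.range t.val, ∀ E : (gaifmanDelete F y).ConnectedComponent,
      (∀ v ∈ compSet E, v ∉ Set.range t.val) → ∀ v ∈ compSet E, v ∈ S → compSet E ⊆ S) :
    IsGlue (Q := induced F (Set.range t.val)) (I := Branch F (Set.range t.val) S)
      (fun b => inducedMk b.cut b.cut_mem) (fun b => (b.toPiece hmem ht).rooted) (induced F S)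
      (fun q => inducedMk (inducedVal q) (htS (inducedVal_mem q)))
      (fun b x => inducedMk (inducedVal (A := F) (S := (b.toPiece hmem ht).domain) x)
        (b.domain_subset hmem ht htS (inducedVal_mem x))) where
  root := fun b => rfl
  core_injective := fun q q' h => inducedVal_injective (inducedMk_injective h)
  ne_core := fun b x hx q h => b.notMem _ ((b.toPiece hmem ht).mem_compSet_of_ne hx)
    ((inducedMk_injective h : inducedVal (A := F) x = inducedVal q) ▸ inducedVal_mem q)
  part_injective := fun b x b' x' hx hx' h => by
    have h := inducedMk_injective h
    have hv := (b.toPiece hmem ht).mem_compSet_of_ne hx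
    have hv' := (b'.toPiece hmem ht).mem_compSet_of_ne hx'
    obtain rfl := Branch.eq_of_mem (gaifman_preconnected hF.1) hv (h ▸ hv' :)
    rw [inducedVal_injective (A := F) (S := (b.toPiece hmem ht).domain) h]
  exists_eq := fun g => by
    by_cases hg : inducedVal g ∈ Set.range t.val
    · exact Or.inl ⟨inducedMk _ hg, rfl⟩
    · obtain ⟨b, hb⟩ := exists_branch hF t hS (inducedVal_mem g) hg
      exact Or.inr ⟨b, inducedMk (A := F) (S := (b.toPiece hmem ht).domain) _ (Or.inr hb), rfl⟩
  rel := fun {n} R z => by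
    constructor
    · intro hR
      by_cases hz : ∀ k, inducedVal (z k) ∈ Set.range t.val
      · exact Or.inl ⟨fun k => inducedMk _ (hz k), hR, rfl⟩
      · push Not at hz
        obtain ⟨k, hk⟩ := hz
        obtain ⟨b, hb⟩ := exists_branch hF t hS (inducedVal_mem (z k)) hk
        have hb' : ∀ i, inducedVal (z i) ∈ (b.toPiece hmem ht).domain := fun i =>
          mem_insert_compSet_of_mem_range (t := ⟨n, R, inducedVal ∘ z, hR⟩) hb ⟨k, rfl⟩ ⟨i, rfl⟩
        exact Or.inr ⟨b, fun i => inducedMk _ (hb' i), hR, rfl⟩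
    · rintro (⟨q, hq, rfl⟩ | ⟨b, x, hx, rfl⟩)
      · exact hq
      · exact hx

end Branches

/-! ### Homomorphisms from trees to structures covered by copies of one structure -/

section Homomorphisms

variable {σ : FirstOrder.Language.{w, v}} [σ.IsRelational] {𝓕 : Set (Bundled.{u} σ.Structure)}

/-- A gluing stays connected without an element of the core if the core does, no part is attached to
that element, and all parts are connected. -/
theorem gaifmanDelete_glueStr_preconnected {Q : Bundled.{u} σ.Structure} {I : Type u} {a : I → Q}
    {X : I → Rooted.{w, v, u} σ} {m : Q} (hQ : (gaifmanDelete Q m).Preconnected)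
    (ha : ∀ i, a i ≠ m) (hX : ∀ i, (gaifman (X i).str).Preconnected) :
    (gaifmanDelete (glueStr a X) (glueCore a X m)).Preconnected := by
  have H := glueStr_isGlue a X
  have hcore : ∀ q, q ≠ m → glueCore a X q ≠ glueCore a X m := fun q hq h =>
    hq (H.core_injective h)
  have hpart : ∀ i x, gluePart a X i x ≠ glueCore a X m := by
    intro i x
    by_cases hx : x = (X i).root
    · rw [hx, H.root]
      exact hcore _ (ha i)
    · exact H.ne_core i x hx m
  have hreach : ∀ z, ∀ hz : z ≠ glueCore a X m, ∃ q, ∃ hq : q ≠ m,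
      (gaifmanDelete (glueStr a X) (glueCore a X m)).Reachable ⟨z, hz⟩
        ⟨glueCore a X q, hcore q hq⟩ := by
    intro z hz
    rcases H.exists_eq z with ⟨q, rfl⟩ | ⟨i, x, rfl⟩
    · exact ⟨q, fun h => hz (congrArg _ h), SimpleGraph.Reachable.refl _⟩
    · let φ : gaifman (X i).str →g gaifmanDelete (glueStr a X) (glueCore a X m) :=
        ⟨fun x => ⟨gluePart a X i x, hpart i x⟩, fun h => gaifman_adj_of_hom
          (fun _ R x hx => relMap_gluePart i R x hx) (H.injective_part i) h⟩
      refine ⟨a i, ha i, ?_⟩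
      have h := (hX i x (X i).root).map φ
      have hr : φ (X i).root = ⟨glueCore a X (a i), hcore _ (ha i)⟩ := Subtype.ext (H.root i)
      rwa [hr] at h
  let ψ : gaifmanDelete Q m →g gaifmanDelete (glueStr a X) (glueCore a X m) :=
    ⟨fun q => ⟨glueCore a X q.1, hcore _ q.2⟩, fun h => gaifman_adj_of_hom
      (fun _ R x hx => relMap_glueCore R x hx) H.core_injective h⟩
  rintro ⟨z, hz⟩ ⟨z', hz'⟩
  obtain ⟨q, hq, h⟩ := hreach z hz
  obtain ⟨q', hq', h'⟩ := hreach z' hz'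
  exact h.trans (((hQ ⟨q, hq⟩ ⟨q', hq'⟩).map ψ).trans h'.symm)

/-- Some piece equivalent to `p` has a homomorphism to `P` that takes its root to `x`. -/
def Realizes (P : Bundled.{u} σ.Structure) (p : Piece 𝓕) (x : P) : Prop :=
  ∃ q : Piece 𝓕, incompatible 𝓕 q.rooted = incompatible 𝓕 p.rooted ∧
    ∃ f : q.rooted.str →[σ] P, f q.rooted.root = x

/-- The inclusion of one induced substructure in another. -/
def inducedInclusion {A : Bundled.{u} σ.Structure} {S S' : Set A} (h : S ⊆ S') :
    induced A S →[σ] induced A S' :=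
  ⟨fun x => inducedMk (inducedVal x) (h (inducedVal_mem x)), fun g => isEmptyElim g,
    fun _ _ hx => hx⟩

variable {P Z : Bundled.{u} σ.Structure} {Λ : Type u} {G : Λ → (P ↪[σ] Z)}

/-- If a tuple of a tree is mapped into one of the copies of `P`, and all branches at the tuple are
realized in `P`, then the branches can be replaced by equivalent pieces so that the resulting
structure maps to `P`. -/
theorem exists_hom_of_realizes {F : Bundled.{u} σ.Structure} (hmem : F ∈ 𝓕) (hG : IsCover P Z G)
    (t : RelTuple F) (ht : (Set.range t.val).Nontrivial) {S : Set F} (htS : Set.range t.val ⊆ S)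
    (f : induced F S →[σ] Z)
    (hb : ∀ (b : Branch F (Set.range t.val) S) (l : Λ) (x : P),
      G l x = f (inducedMk b.cut (htS b.cut_mem)) → Realizes P (b.toPiece hmem ht) x) :
    ∃ q : Branch F (Set.range t.val) S → Piece 𝓕,
      (∀ b, incompatible 𝓕 (q b).rooted = incompatible 𝓕 (b.toPiece hmem ht).rooted) ∧
      ∃ (l : Λ) (g : glueStr (Q := induced F (Set.range t.val))
          (fun b : Branch F (Set.range t.val) S => inducedMk b.cut b.cut_mem)
          (fun b => (q b).rooted) →[σ] P),
        ∀ y (hy : y ∈ Set.range t.val),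
          G l (g (glueCore _ _ (inducedMk y hy))) = f (inducedMk y (htS hy)) := by
  obtain ⟨l, x, hx⟩ := hG.exists_comp_eq t.rel _
    (HomClass.map_rel f t.rel (fun i => inducedMk (t.val i) (htS ⟨i, rfl⟩)) t.holds)
  have hy : ∀ y : induced F (Set.range t.val), ∃ z, G l z = f (inducedInclusion htS y) := by
    intro y
    obtain ⟨i, hi⟩ := inducedVal_mem y
    refine ⟨x i, (congrFun hx i).trans (congrArg f ?_)⟩
    exact inducedVal_injective hi
  choose h hh using hy
  choose q hq f' hf' using fun b : Branch F (Set.range t.val) S =>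
    hb b l (h (inducedMk b.cut b.cut_mem)) (hh _)
  have hrel : ∀ (n : ℕ) (R : σ.Relations n) (y : Fin n → induced F (Set.range t.val)),
      Structure.RelMap R y → Structure.RelMap R (h ∘ y) := by
    intro n R y hy
    rw [← StrongHomClass.map_rel (G l)]
    have hcomp : G l ∘ h ∘ y = f ∘ inducedInclusion htS ∘ y := funext fun k => hh (y k)
    rw [hcomp]
    exact HomClass.map_rel f R _ (HomClass.map_rel (inducedInclusion htS) R y hy)
  obtain ⟨g, hg⟩ := exists_glueHom (X := fun b => (q b).rooted)
    (a := fun b : Branch F (Set.range t.val) S => inducedMk b.cut b.cut_mem)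
    (⟨h, fun g => isEmptyElim g, fun R y => hrel _ R y⟩ : induced F (Set.range t.val) →[σ] P)
    f' hf'
  exact ⟨q, hq, l, g, fun y hy => (congrArg (G l) (hg _)).trans (hh _)⟩

/-- If the copies of `P` covering `Z` agree on the pieces that they realize at common elements, then
every piece with a homomorphism to `Z` is realized in each copy that contains the image of its root.
The root lies in a tuple of the piece, the branches at the other elements of this tuple are smaller
pieces, and replacing them yields an equivalent piece that maps to the copy containing the tuple. -/
theorem realizes_of_hom (h𝓕 : ∀ F ∈ 𝓕, Finite F ∧ IsSigmaTree F) (hG : IsCover P Z G)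
    (hcompat : ∀ (p : Piece 𝓕) (l l' : Λ) (x x' : P), G l x = G l' x' → Realizes P p x →
      Realizes P p x')
    (p : Piece 𝓕) (f : p.rooted.str →[σ] Z) (l : Λ) (x : P) (hx : G l x = f p.rooted.root) :
    Realizes P p x := by
  induction hn : p.domain.ncard using Nat.strong_induction_on generalizing p l x with
  | _ n ih =>
  have : Finite p.tree := (h𝓕 _ p.mem).1
  have hF := (h𝓕 _ p.mem).2.2
  have hconn := gaifman_preconnected hF.1
  obtain ⟨v, hv, hne, t, hvt, hmt⟩ := exists_adj_of_preconnected hconn p.component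
  have ht : (Set.range t.val).Nontrivial := ⟨v, hvt, p.cut, hmt, hne⟩
  have htS : Set.range t.val ⊆ p.domain := fun w hw => mem_insert_compSet_of_mem_range hv hvt hw
  -- Of the components of the tree without the cut, only that of the piece meets the piece, and it
  -- also meets `t`.
  have hcut : ∀ E : (gaifmanDelete p.tree p.cut).ConnectedComponent,
      (∀ v ∈ compSet E, v ∉ Set.range t.val) → ∀ w ∈ compSet E, w ∉ p.domain := by
    rintro E hE w hw (rfl | hwp)
    · exact ne_of_mem_compSet hw rfl
    · exact hE v ((mem_compSet_iff_reachable hw hne).2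
        ((mem_compSet_iff_reachable hwp hne).1 hv)) hvt
  have hS : ∀ y ∈ Set.range t.val, ∀ E : (gaifmanDelete p.tree y).ConnectedComponent,
      (∀ v ∈ compSet E, v ∉ Set.range t.val) → ∀ v ∈ compSet E, v ∈ p.domain →
      compSet E ⊆ p.domain := by
    intro y hy E hE w hw hwS z hz
    by_cases hyc : y = p.cut
    · subst hyc
      exact absurd hwS (hcut E hE w hw)
    · have hzc : z ≠ p.cut := fun h => hE z hz (h ▸ hmt)
      have hyp : y ∈ compSet p.component := (htS hy).resolve_left hyc
      exact Or.inr ((mem_compSet_iff_reachable hyp hzc).2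
        (reachable_of_notMem_compSet hconn hyc (fun h => hE _ h hmt) hz hzc))
  have hbcut : ∀ b : Branch p.tree (Set.range t.val) p.domain, b.cut ≠ p.cut := by
    rintro ⟨y, hy, E, hE, hES⟩ rfl
    obtain ⟨w, hw⟩ := compSet_nonempty (E := E)
    exact hcut E hE w hw (hES hw)
  obtain ⟨q, hq, l', g, hg⟩ := exists_hom_of_realizes p.mem hG t ht htS f fun b l x hx => by
    have hsub : (b.toPiece p.mem ht).domain ⊆ p.domain := fun _ => b.domain_subset p.mem ht htS
    refine ih _ ?_ (b.toPiece p.mem ht) (f.comp (inducedInclusion hsub)) l x hx rfl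
    rw [← hn]
    refine Set.ncard_lt_ncard ⟨hsub, fun h => ?_⟩ p.domain.toFinite
    rcases h (Set.mem_insert _ _ : p.cut ∈ p.domain) with h | h
    · exact hbcut b h.symm
    · exact b.notMem _ h hmt
  obtain ⟨e, he, -⟩ := (branch_isGlue p.mem hF t ht htS hS).exists_equiv
  have hinc : incompatible 𝓕 p.rooted = incompatible 𝓕
      ⟨glueStr _ fun b => (q b).rooted, glueCore _ _ (inducedMk p.cut hmt)⟩ :=
    (incompatible_congr (X := p.rooted) e (he (inducedMk p.cut hmt))).trans
      (incompatible_glueStr_congr _ _ _ (fun b => (hq b).symm) _)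
  have hrest : p.rest ∈ incompatible 𝓕 p.rooted :=
    p.isJoin_rest.mem_incompatible_iff.2 ⟨_, p.mem, ⟨FirstOrder.Language.Equiv.refl σ _⟩⟩
  rw [hinc] at hrest
  obtain ⟨F', hF', ⟨e'⟩⟩ := hrest
  have hclique : (gaifmanDelete (induced p.tree (Set.range t.val))
      (inducedMk p.cut hmt)).Preconnected := by
    rintro ⟨y, hy⟩ ⟨z, hz⟩
    by_cases hyz : y = z
    · subst hyz
      exact SimpleGraph.Reachable.refl _
    · have hmem : ∀ y : induced p.tree (Set.range t.val),
          y ∈ Set.range fun i => inducedMk (S := Set.range t.val) (t.val i) ⟨i, rfl⟩ := by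
        intro y
        obtain ⟨i, hi⟩ := inducedVal_mem y
        exact ⟨i, inducedVal_injective hi⟩
      exact SimpleGraph.Adj.reachable (G := gaifmanDelete _ _)
        ⟨hyz, ⟨t.arity, t.rel, _, t.holds⟩, hmem y, hmem z⟩
  obtain ⟨p', ε, hε⟩ := exists_piece_of_isJoin (𝓕 := 𝓕)
    ((join_isJoin ⟨glueStr _ fun b => (q b).rooted, glueCore _ _ (inducedMk p.cut hmt)⟩
      p.rest).congr e' (fun _ => FirstOrder.Language.Equiv.refl σ _) fun _ => rfl) hF'
    (gaifmanDelete_glueStr_preconnected hclique (fun b h => hbcut b (inducedMk_injective h))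
      fun b => (q b).gaifman_preconnected (gaifman_preconnected (h𝓕 _ (q b).mem).2.2.1))
    ⟨glueCore _ _ (inducedMk v hvt), fun h => hne (inducedMk_injective
      ((glueStr_isGlue _ _).core_injective h))⟩
    p.exists_ne_root_rest
    (fun n R h => relMap_glueCore R (fun _ => inducedMk p.cut hmt) h)
  refine hcompat p l' l _ x ((hg p.cut hmt).trans hx.symm)
    ⟨p', ?_, g.comp ε.symm.toHom, ?_⟩
  · rw [hinc]
    exact incompatible_congr (X := p'.rooted) ε hε
  · rw [← hε]
    exact congrArg g (ε.symm_apply_apply _)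

/-- A structure covered by copies of `P` that agree on the pieces they realize admits no homomorphism
from a member of `𝓕` if `P` does not. -/
theorem isEmpty_hom_of_isCover (h𝓕 : ∀ F ∈ 𝓕, Finite F ∧ IsSigmaTree F) [Nonempty Λ]
    (hG : IsCover P Z G)
    (hcompat : ∀ (p : Piece 𝓕) (l l' : Λ) (x x' : P), G l x = G l' x' → Realizes P p x →
      Realizes P p x')
    (hP : ∀ F ∈ 𝓕, IsEmpty (F →[σ] P)) (F : Bundled.{u} σ.Structure) (hmem : F ∈ 𝓕) :
    IsEmpty (F →[σ] Z) := by
  refine ⟨fun f => ?_⟩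
  have : Finite F := (h𝓕 F hmem).1
  have hF := (h𝓕 F hmem).2.2
  by_cases ht : ∃ t : RelTuple F, (Set.range t.val).Nontrivial
  · obtain ⟨t, ht⟩ := ht
    have hval : ∀ (n : ℕ) (R : σ.Relations n) (x : Fin n → induced F Set.univ),
        Structure.RelMap R (inducedVal ∘ x) ↔ Structure.RelMap R x := fun _ _ _ => Iff.rfl
    obtain ⟨e₀, -⟩ := exists_equiv_of_bijective (M := induced F Set.univ) inducedVal
      ⟨inducedVal_injective, fun x => ⟨inducedMk x trivial, rfl⟩⟩ hval
    obtain ⟨q, hq, l, g, -⟩ := exists_hom_of_realizes hmem hG t ht (Set.subset_univ _)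
      (f.comp e₀.toHom) fun b l x hx => realizes_of_hom h𝓕 hG hcompat (b.toPiece hmem ht)
        ((f.comp e₀.toHom).comp (inducedInclusion (Set.subset_univ _))) l x hx
    obtain ⟨e, -⟩ := (branch_isGlue hmem hF t ht (Set.subset_univ _)
      fun _ _ E _ _ _ _ => Set.subset_univ (compSet E)).exists_equiv
    obtain ⟨F', hF', ⟨e'⟩⟩ := (isoMem_glueStr_congr _ _ _ hq).2 ⟨F, hmem, ⟨e₀.comp e⟩⟩
    exact (hP F' hF').false (g.comp e'.symm.toHom)
  -- A tree without tuples of two or more elements has at most one element.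
  · have hsub : ∀ v w : F, v = w := by
      intro v w
      have h := (SimpleGraph.reachable_iff_reflTransGen _ _).1 (gaifman_preconnected hF.1 v w)
      rcases Relation.ReflTransGen.cases_head h with h | ⟨z, ⟨hne, t, hv, hz⟩, -⟩
      · exact h
      · exact absurd ⟨t, v, hv, z, hz, hne⟩ ht
    obtain ⟨l, hl⟩ : ∃ l, ∀ v, ∃ x, G l x = f v := by
      rcases isEmpty_or_nonempty F with hemp | ⟨⟨v⟩⟩
      · exact ⟨Classical.arbitrary Λ, fun v => hemp.elim v⟩
      · obtain ⟨l, x, h⟩ := hG.exists_eq (f v)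
        exact ⟨l, fun w => ⟨x, hsub v w ▸ h⟩⟩
    choose h hh using hl
    refine (hP F hmem).false ⟨h, fun g => isEmptyElim g, fun R x hx => ?_⟩
    rw [← StrongHomClass.map_rel (G l)]
    have hcomp : G l ∘ h ∘ x = f ∘ x := funext fun k => hh (x k)
    rw [hcomp]
    exact HomClass.map_rel f R x hx

end Homomorphisms

/-! ### Canonical structures and the ordered expanded class -/

section OrderedExpandedClass

/-- An embedding is an embedding of the reducts. -/
def reductEmbedding {L : FirstOrder.Language.{w, v}} {L' : FirstOrder.Language.{w', v'}}
    (φ : L →ᴸ L') {A B : Bundled.{u} L'.Structure} (f : A ↪[L'] B) : reduct φ A ↪[L] reduct φ B :=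
  ⟨f.toEmbedding, fun g x => f.map_fun' (φ.onFunction g) x,
    fun R x => f.map_rel' (φ.onRelation R) x⟩

variable {σ : FirstOrder.Language.{w, v}} [σ.IsRelational] {𝓕 : Set (Bundled.{u} σ.Structure)}

instance : (pieceLang 𝓕).IsRelational :=
  fun _ => inferInstanceAs (IsEmpty Empty)

/-- The equivalence class of a piece. -/
def pieceClass (p : Piece 𝓕) : PieceClass 𝓕 :=
  Quotient.mk (pieceSetoid 𝓕) p

theorem realizes_iff_of_mem_canonicalClass {P : Bundled.{u} (expLang 𝓕).Structure}
    (hP : P ∈ canonicalClass 𝓕) (p : Piece 𝓕) (x : P) :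
    Realizes (reduct LHom.sumInl P) p x ↔
      Structure.RelMap (pieceSymb (pieceClass p)) ![x] :=
  Iff.trans (exists_congr fun _ => and_congr_left' (Quotient.eq (r := pieceSetoid 𝓕)).symm)
    (hP.2 (pieceClass p) x).symm

/-- A finite structure covered by copies of a canonical structure is canonical. -/
theorem closedUnderCovers_canonicalClass (h𝓕 : ∀ F ∈ 𝓕, Finite F ∧ IsSigmaTree F) :
    ClosedUnderCovers (canonicalClass 𝓕) := by
  intro P hP Z Λ G hfin hΛ hG
  have hvec : ∀ l (x : P), G l ∘ ![x] = ![G l x] := fun l x => by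
    funext i
    fin_cases i
    rfl
  have hlabel : ∀ (𝔐 : PieceClass 𝓕) l (x : P), Structure.RelMap (pieceSymb 𝔐) ![G l x] ↔
      Structure.RelMap (pieceSymb 𝔐) ![x] := fun 𝔐 l x => by
    rw [← hvec, StrongHomClass.map_rel]
  have hG' : IsCover (reduct LHom.sumInl P) (reduct LHom.sumInl Z)
      fun l => reductEmbedding (LHom.sumInl : σ →ᴸ expLang 𝓕) (G l) :=
    ⟨hG.exists_eq, fun R z hz => hG.exists_comp_eq (LHom.sumInl.onRelation R) z hz⟩
  have hcompat : ∀ (p : Piece 𝓕) (l l' : Λ) (x x' : P), G l x = G l' x' →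
      Realizes (reduct LHom.sumInl P) p x → Realizes (reduct LHom.sumInl P) p x' := by
    intro p l l' x x' h hx
    have hx := (hlabel (pieceClass p) l x).2 ((realizes_iff_of_mem_canonicalClass hP p x).1 hx)
    rw [h] at hx
    exact (realizes_iff_of_mem_canonicalClass hP p x').2 ((hlabel (pieceClass p) l' x').1 hx)
  refine ⟨⟨hfin, isEmpty_hom_of_isCover h𝓕 hG' hcompat hP.1.2⟩, fun 𝔐 z => ⟨fun hz => ?_, ?_⟩⟩
  · obtain ⟨l, x, rfl⟩ := hG.exists_eq z
    rw [hlabel, hP.2] at hz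
    obtain ⟨p, hp, f, hf⟩ := hz
    exact ⟨p, hp, (reductEmbedding LHom.sumInl (G l)).toHom.comp f, congrArg (G l) hf⟩
  · rintro ⟨p, rfl, f, hf⟩
    obtain ⟨l, x, rfl⟩ := hG.exists_eq z
    exact (hlabel (pieceClass p) l x).2 ((realizes_iff_of_mem_canonicalClass hP p x).1
      (realizes_of_hom h𝓕 hG' hcompat p f l x hf.symm))

/-- An embedding of the reducts that preserves the order is an embedding of ordered structures. -/
def orderedEmbedding {A B : Bundled.{u} (ordLang 𝓕).Structure} [LinearOrder A] [LinearOrder B]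
    [(ordLang 𝓕).OrderedStructure A] [(ordLang 𝓕).OrderedStructure B]
    (f : reduct (LHom.sumInl : expLang 𝓕 →ᴸ ordLang 𝓕) A ↪[expLang 𝓕] reduct LHom.sumInl B)
    (hf : StrictMono (α := A) (β := B) fun a => f a) : A ↪[ordLang 𝓕] B :=
  ⟨f.toEmbedding, fun g => isEmptyElim g, fun {n} R x => by
    rcases R with R | R
    · exact f.map_rel' R x
    · cases R
      exact (relMap_leSymb (L := ordLang 𝓕) _).trans
        (hf.le_iff_le.trans (relMap_leSymb (L := ordLang 𝓕) x).symm)⟩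

theorem strictMono_of_embedding {A B : Bundled.{u} (ordLang 𝓕).Structure} [LinearOrder A]
    [LinearOrder B] [(ordLang 𝓕).OrderedStructure A] [(ordLang 𝓕).OrderedStructure B]
    (f : A ↪[ordLang 𝓕] B) : StrictMono f := by
  refine Monotone.strictMono_of_injective (fun x y h => ?_) f.injective
  have h' := (StrongHomClass.map_rel f (leSymb : (ordLang 𝓕).Relations 2) ![x, y]).2
    ((relMap_leSymb _).2 h)
  exact (relMap_leSymb _).1 h'

/-- The expansion of a structure by a linear ordering. -/
def withOrder (P : Bundled.{u} (expLang 𝓕).Structure) (o : LinearOrder P) :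
    Bundled.{u} (ordLang 𝓕).Structure :=
  letI := orderStructure P
  ⟨P, inferInstance⟩

end OrderedExpandedClass

end RamseyTrees

theorem theorem3p2 (σ : FirstOrder.Language.{w, v}) [σ.IsRelational]
    [Finite (Σ n, σ.Relations n)]
    (𝓕 : Set (CategoryTheory.Bundled.{u} σ.Structure))
    (h𝓕 : ∀ F ∈ 𝓕, Finite F ∧ RamseyTrees.IsSigmaTree F) :
    RamseyTrees.IsRamseyClass (RamseyTrees.orderedExpandedClass 𝓕) := by
  open RamseyTrees in
  rintro A ⟨⟨oA, hoA⟩, A', hA', ⟨eA⟩⟩ B ⟨⟨oB, hoB⟩, P, hP, ⟨e⟩⟩ r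
  classical
  rcases Nat.eq_zero_or_pos r with rfl | hr
  -- Without colours the embeddings of `A` into itself cannot be coloured.
  · exact ⟨A, ⟨⟨oA, hoA⟩, A', hA', ⟨eA⟩⟩, fun χ => (χ (Embedding.refl _ _)).elim0⟩
  have : Finite A' := hA'.1.1
  have : Finite (reduct LHom.sumInl A) := Finite.of_injective eA eA.injective
  let oA' : LinearOrder (reduct LHom.sumInl A) := oA
  let oB' : LinearOrder (reduct LHom.sumInl B) := oB
  obtain ⟨C, hC, N, π, hπ⟩ := exists_ramsey_of_closedUnderCovers (fun P hP => hP.1.1)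
    (closedUnderCovers_canonicalClass h𝓕) (reduct LHom.sumInl A) (reduct LHom.sumInl B) P hP e hr
  -- The elements of `C` are ordered by `π`, and arbitrarily where `π` agrees.
  have : Finite C := hC.1.1
  obtain ⟨n, ⟨ε⟩⟩ := Finite.exists_equiv_fin C
  let oC : LinearOrder C := LinearOrder.lift' (fun x => toLex (π x, ε x)) fun x y h =>
    ε.injective (Prod.mk.inj (toLex.injective h)).2
  have hlt : ∀ x y : C, π x < π y → x < y := fun x y h => Prod.Lex.toLex_lt_toLex.2 (Or.inl h)
  let oD : LinearOrder (withOrder C oC) := oC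
  have hoD : (ordLang 𝓕).OrderedStructure (withOrder C oC) := ⟨fun x => Iff.rfl⟩
  refine ⟨withOrder C oC, ⟨⟨oC, hoD⟩, C, hC, ⟨Embedding.refl _ _⟩⟩, fun χ => ?_⟩
  obtain ⟨g, j, hg, hj⟩ := hπ fun f => if h : StrictMono f then
    χ (orderedEmbedding (A := A) (B := withOrder C oC) f h) else ⟨0, hr⟩
  have hg' : StrictMono g := fun x y h => hlt _ _ (hg h)
  refine ⟨orderedEmbedding (A := B) (B := withOrder C oC) g hg', j, fun f => ?_⟩
  have hf : StrictMono f := strictMono_of_embedding f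
  exact (dif_pos (hg'.comp hf)).symm.trans (hj (reductEmbedding LHom.sumInl f) hf)
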